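/- Let $k$ be a commutative ring and $A$ a $k$-module. **Double algebras.** A double algebra is a $k$-module $A$ with two associative unital $k$-algebra structures $V=\langle A,\circ,e\rangle$ and $H=\langle A,\star,i\rangle$ such that, with $\varphi_L(a)=a\star e$, $\varphi_R(a)=e\star a$, $\varphi_B(a)=a\circ i$, $\varphi_T(a)=i\circ a$, the following hold for all $a,b\in A$: $$\begin{aligned} &\varphi_L(a)\circ b=\varphi_B\varphi_L(a)\star b, && a\circ\varphi_L(b)=\varphi_T\varphi_L(b)\star a, && \varphi_B(a)\star b=\varphi_L\varphi_B(a)\circ b, && a\star\varphi_B(b)=\varphi_R\varphi_B(b)\circ a,\\ &a\circ\varphi_R(b)=a\star\varphi_T\varphi_R(b), && \varphi_R(a)\circ b=b\star\varphi_B\varphi_R(a), && a\star\varphi_T(b)=a\circ\varphi_R\varphi_T(b), && \varphi_T(a)\star b=b\circ\varphi_L\varphi_T(a). \end{aligned}$$ Then $L=\varphi_L(A)$, $R=\varphi_R(A)$ are subalgebras of $V$, and $B=\varphi_B(A)$, $T=\varphi_T(A)$ are subalgebras of $H$. For $X=L,R$ (resp. $X=B,T$), $A\otimes_X A$ is the tensor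 product over $X$ with respect to right and left multiplication by $X$ in $V$ (resp. in $H$). **Frobenius.** The double algebra is Frobenius if $\varphi_L,\varphi_R$ (as maps $V\to L$, $V\to R$) and $\varphi_B,\varphi_T$ (as maps $H\to B$, $H\to T$) are Frobenius homomorphisms, i.e. $X$-$X$-bimodule maps $\varphi$ possessing finitely many elements $x_j,y_j\in A$ (dual bases) with $\sum_j\varphi(ax_j)y_j=a=\sum_j x_j\varphi(y_ja)$ for all $a$. The Abrams–Kadison comultiplication of $\varphi$ is $\Delta(a)=\sum_j ax_j\otimes y_j\in A\otimes_X A$, which does not depend on the dual bases. This gives $$\Delta_B(a)=a_{(1)}\otimes a_{(2)}\in A\otimes_B A,\quad \Delta_T(a)=a^{(1)}\otimes a^{(2)}\in A\otimes_T A,\quad \Delta_L(a)=a_{[1]}\otimes a_{[2]}\in A\otimes_L A,\quad \Delta_R(a)=a^{[1]}\otimes a^{[2]}\in A\otimes_R A$$ (products with the dual bases are taken in $H$ for $B,T$ and in $V$ for $L,R$). **Distributive.** A Frobenius double algebra is distributive if for all $a,a',a''\in A$ $$\begin{aligned} a\circ(a'\star a'')&=(a_{(1)}\circ a')\star(a_{(2)}\circ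 a''), & a\star(a'\circ a'')&=(a_{[1]}\star a')\circ(a_{[2]}\star a''),\\ (a'\star a'')\circ a&=(a'\circ a^{(1)})\star(a''\circ a^{(2)}), & (a'\circ a'')\star a&=(a'\star a^{[1]})\circ(a''\star a^{[2]}). \end{aligned}$$ **Antipode.** An antipode is a $k$-linear map $S\colon A\to A$ such that for all $a,a',a''\in A$ $$\begin{aligned} \varphi_B(a'\star(a''\circ a))&=\varphi_B((a'\circ S(a))\star a''), & \varphi_R(a'\circ(a\star a''))&=\varphi_R((S(a)\star a')\circ a''),\\ \varphi_L((a'\star a)\circ a'')&=\varphi_L(a'\circ(a''\star S(a))), & \varphi_T((a\circ a')\star a'')&=\varphi_T(a'\star(S(a)\circ a'')). \end{aligned}$$ **Takeuchi products.** The Takeuchi products are the $k$-submodules $$\begin{aligned} V\times_B V&=\{\textstyle\sum a\otimes a'\in A\otimes_B A : \sum a\circ\varphi_R(b)\otimes a'=\sum a\otimes a'\circ\varphi_L(b)\ \ \forall b\in B\},\\ V\times_T V&=\{\textstyle\sum a\otimes a'\in A\otimes_T A : \sum \varphi_R(t)\circ a\otimes a'=\sum a\otimes \varphi_L(t)\circ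 a'\ \ \forall t\in T\},\\ H\times_L H&=\{\textstyle\sum a\otimes a'\in A\otimes_L A : \sum a\star\varphi_T(l)\otimes a'=\sum a\otimes a'\star\varphi_B(l)\ \ \forall l\in L\},\\ H\times_R H&=\{\textstyle\sum a\otimes a'\in A\otimes_R A : \sum \varphi_T(r)\star a\otimes a'=\sum a\otimes \varphi_B(r)\star a'\ \ \forall r\in R\}, \end{aligned}$$ which are unital $k$-algebras under termwise multiplication ($\circ$ for the first two with unit $e\otimes e$, $\star$ for the last two with unit $i\otimes i$). **Proposition.** A Frobenius double algebra $\langle A,\circ,e,\star,i\rangle$ is distributive if and only if both of the following hold: 1. there exists an antipode $S\colon A\to A$; 2. the comultiplications take values in the Takeuchi products and are homomorphisms of unital $k$-algebras $$\Delta_B\colon V\to V\times_B V,\qquad \Delta_T\colon V\to V\times_T V,\qquad \Delta_L\colon H\to H\times_L H,\qquad \Delta_R\colon H\to H\times_R H.$$ -/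

import Mathlib

open scoped TensorProduct

/-! ### Unital associative algebra structures on a fixed module -/

/-- A unital associative `k`-algebra structure on the `k`-module `A`. -/
structure AlgStr (k A : Type*) [CommRing k] [AddCommGroup A] [Module k A] where
  mul : A →ₗ[k] A →ₗ[k] A
  one : A
  mul_assoc : ∀ a b c, mul (mul a b) c = mul a (mul b c)
  one_mul : ∀ a, mul one a = a
  mul_one : ∀ a, mul a one = a

/-- `a *[M] b` is the product of `a` and `b` for the algebra structure `M`. -/
notation:70 a:70 " *[" M "] " b:71 => AlgStr.mul M a b

namespace AlgStr

section

variable {k A A' : Type*} [CommRing k] [AddCommGroup A] [Module k A]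
  [AddCommGroup A'] [Module k A']

/-- A `k`-linear map is a homomorphism of unital algebras. -/
structure IsAlgHom (M : AlgStr k A) (M' : AlgStr k A') (f : A →ₗ[k] A') : Prop where
  map_one : f M.one = M'.one
  map_mul : ∀ a b, f (a *[M] b) = f a *[M'] f b

/-- The termwise product `(a ⊗ a') (b ⊗ b') = a b ⊗ a' b'` on `A ⊗[k] A`. -/
noncomputable def tensor (M : AlgStr k A) : AlgStr k (A ⊗[k] A) where
  mul := TensorProduct.map₂ M.mul M.mul
  one := M.one ⊗ₜ[k] M.one
  mul_assoc a b c := by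
    induction a using TensorProduct.induction_on with
    | zero => simp
    | add x y hx hy => simp only [map_add, LinearMap.add_apply, hx, hy]
    | tmul a a' =>
      induction b using TensorProduct.induction_on with
      | zero => simp
      | add x y hx hy => simp only [map_add, LinearMap.add_apply, hx, hy]
      | tmul b b' =>
        induction c using TensorProduct.induction_on with
        | zero => simp
        | add x y hx hy => simp only [map_add, hx, hy]
        | tmul c c' => simp [TensorProduct.map₂_apply_tmul, M.mul_assoc]
  one_mul a := by
    induction a using TensorProduct.induction_on with
    | zero => simp
    | add x y hx hy => simp only [map_add, hx, hy]
    | tmul a a' => simp [TensorProduct.map₂_apply_tmul, M.one_mul]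
  mul_one a := by
    induction a using TensorProduct.induction_on with
    | zero => simp
    | add x y hx hy => simp only [map_add, LinearMap.add_apply, hx, hy]
    | tmul a a' => simp [TensorProduct.map₂_apply_tmul, M.mul_one]

theorem tensor_mul_tmul (M : AlgStr k A) (a a' b b' : A) :
    (a ⊗ₜ[k] a') *[M.tensor] (b ⊗ₜ[k] b') = (a *[M] b) ⊗ₜ[k] (a' *[M] b') := by
  simp [tensor, TensorProduct.map₂_apply_tmul]

/-! ### Tensor products over a (noncommutative) subalgebra -/

/-- The relations `a x ⊗ a' = a ⊗ x a'`, for `x ∈ X`. -/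
def balRel (M : AlgStr k A) (X : Submodule k A) : Submodule k (A ⊗[k] A) :=
  Submodule.span k {p | ∃ a a' : A, ∃ x ∈ X,
    p = (a *[M] x) ⊗ₜ[k] a' - a ⊗ₜ[k] (x *[M] a')}

/-- The tensor product `A ⊗_X A` over a subalgebra `X` of the algebra `M` on `A`, formed with the
right and left multiplication actions of `X` on `A`. -/
abbrev BalTensor (M : AlgStr k A) (X : Submodule k A) : Type _ := (A ⊗[k] A) ⧸ M.balRel X

/-- The element `a ⊗ a'` of `A ⊗_X A`. -/
def btmul (M : AlgStr k A) (X : Submodule k A) (a a' : A) : M.BalTensor X :=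
  (M.balRel X).mkQ (a ⊗ₜ[k] a')

theorem btmul_balanced (M : AlgStr k A) (X : Submodule k A) (a a' : A) {x : A} (hx : x ∈ X) :
    M.btmul X (a *[M] x) a' = M.btmul X a (x *[M] a') := by
  refine (Submodule.Quotient.eq _).2 (Submodule.subset_span ⟨a, a', x, hx, rfl⟩)

theorem btmul_sum_right (M : AlgStr k A) (X : Submodule k A) {ι : Type*} (s : Finset ι)
    (a : A) (f : ι → A) : M.btmul X a (∑ i ∈ s, f i) = ∑ i ∈ s, M.btmul X a (f i) := by
  simp only [btmul, TensorProduct.tmul_sum, map_sum]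

theorem btmul_sum_left (M : AlgStr k A) (X : Submodule k A) {ι : Type*} (s : Finset ι)
    (a : A) (f : ι → A) : M.btmul X (∑ i ∈ s, f i) a = ∑ i ∈ s, M.btmul X (f i) a := by
  simp only [btmul, TensorProduct.sum_tmul, map_sum]

/-- A balanced bilinear map `f` induces a linear map on `A ⊗_X A`, sending `a ⊗ a'` to
`f a a'`. -/
def btlift (M : AlgStr k A) (X : Submodule k A) (f : A →ₗ[k] A →ₗ[k] A')
    (hf : ∀ a a', ∀ x ∈ X, f (a *[M] x) a' = f a (x *[M] a')) : M.BalTensor X →ₗ[k] A' :=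
  (M.balRel X).liftQ (TensorProduct.lift f) (by
    refine Submodule.span_le.2 ?_
    rintro _ ⟨a, a', x, hx, rfl⟩
    simp [hf a a' x hx])

theorem btlift_btmul (M : AlgStr k A) (X : Submodule k A) (f : A →ₗ[k] A →ₗ[k] A')
    (hf : ∀ a a', ∀ x ∈ X, f (a *[M] x) a' = f a (x *[M] a')) (a a' : A) :
    M.btlift X f hf (M.btmul X a a') = f a a' := by
  show TensorProduct.lift f (a ⊗ₜ[k] a') = f a a'
  simp

/-! ### Frobenius homomorphisms and the Abrams–Kadison comultiplication -/

/-- The families `x`, `y` form dual bases for `φ`. -/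
structure IsDualBasis (M : AlgStr k A) (φ : A →ₗ[k] A) {n : ℕ} (x y : Fin n → A) : Prop where
  sum_left : ∀ a, ∑ j, φ (a *[M] x j) *[M] y j = a
  sum_right : ∀ a, ∑ j, x j *[M] φ (y j *[M] a) = a

/-- `X` is a unital subalgebra of `M` and `φ`, which takes values in `X`, is a Frobenius
homomorphism: an `X`-`X`-bimodule map with dual bases. -/
structure IsFrobeniusHom (M : AlgStr k A) (X : Submodule k A) (φ : A →ₗ[k] A) : Prop where
  one_mem : M.one ∈ X
  mul_mem : ∀ x ∈ X, ∀ y ∈ X, x *[M] y ∈ X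
  map_mem : ∀ a, φ a ∈ X
  map_left : ∀ x ∈ X, ∀ a, φ (x *[M] a) = x *[M] φ a
  map_right : ∀ x ∈ X, ∀ a, φ (a *[M] x) = φ a *[M] x
  exists_dualBasis : ∃ (n : ℕ) (x y : Fin n → A), M.IsDualBasis φ x y

/-- The Abrams–Kadison comultiplication `Δ a = ∑ⱼ a xⱼ ⊗ yⱼ ∈ A ⊗_X A` of a Frobenius homomorphism
with dual bases `xⱼ`, `yⱼ`; it does not depend on the dual bases (`comul_eq`). -/
noncomputable def IsFrobeniusHom.comul {M : AlgStr k A} {X : Submodule k A} {φ : A →ₗ[k] A}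
    (h : M.IsFrobeniusHom X φ) (a : A) : M.BalTensor X :=
  ∑ j, M.btmul X (a *[M] h.exists_dualBasis.choose_spec.choose j)
    (h.exists_dualBasis.choose_spec.choose_spec.choose j)

theorem IsFrobeniusHom.comul_eq {M : AlgStr k A} {X : Submodule k A} {φ : A →ₗ[k] A}
    (h : M.IsFrobeniusHom X φ) {n : ℕ} {x y : Fin n → A} (hxy : M.IsDualBasis φ x y) (a : A) :
    h.comul a = ∑ j, M.btmul X (a *[M] x j) (y j) := by
  have key : ∀ {m n : ℕ} {x y : Fin m → A} {x' y' : Fin n → A}, M.IsDualBasis φ x y →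
      M.IsDualBasis φ x' y' → ∑ j, M.btmul X (a *[M] x j) (y j) =
        ∑ i, ∑ j, M.btmul X (a *[M] x i) (φ (y i *[M] x' j) *[M] y' j) := by
    intro m n x y x' y' _ h'
    refine Finset.sum_congr rfl fun i _ => ?_
    rw [← M.btmul_sum_right, h'.sum_left]
  have h₀ := h.exists_dualBasis.choose_spec.choose_spec.choose_spec
  unfold IsFrobeniusHom.comul
  rw [key h₀ hxy, Finset.sum_comm]
  refine Finset.sum_congr rfl fun j _ => ?_
  simp_rw [← M.btmul_balanced X _ _ (h.map_mem _), M.mul_assoc]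
  rw [← M.btmul_sum_left, ← map_sum, h₀.sum_right]

/-! ### Takeuchi products -/

/-- Let `T₀` be a submodule of the algebra `M` on `P` that contains `1`, is closed under products and
normalizes the submodule `N`. Then the image of `T₀` in `P ⧸ N` is an algebra with product
`[p] [q] = [p q]` (`subquot_mul`). -/
noncomputable def subquot (M : AlgStr k A) (N T₀ : Submodule k A)
    (hone : M.one ∈ T₀) (hmul : ∀ p ∈ T₀, ∀ q ∈ T₀, p *[M] q ∈ T₀)
    (hl : ∀ p ∈ T₀, ∀ q ∈ N, p *[M] q ∈ N) (hr : ∀ p ∈ N, ∀ q ∈ T₀, p *[M] q ∈ N) :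
    AlgStr k (T₀.map N.mkQ) :=
  let rep : (T₀.map N.mkQ) → A := fun x => ((Submodule.mem_map).1 x.2).choose
  have rep_mem : ∀ x, rep x ∈ T₀ := fun x => ((Submodule.mem_map).1 x.2).choose_spec.1
  have mk_rep : ∀ x, N.mkQ (rep x) = x := fun x => ((Submodule.mem_map).1 x.2).choose_spec.2
  let mulFun : (T₀.map N.mkQ) → (T₀.map N.mkQ) → (T₀.map N.mkQ) := fun x y =>
    ⟨N.mkQ (rep x *[M] rep y),
      Submodule.mem_map_of_mem (hmul _ (rep_mem x) _ (rep_mem y))⟩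
  have key : ∀ (x y : T₀.map N.mkQ) (p q : A), p ∈ T₀ → q ∈ T₀ → N.mkQ p = x → N.mkQ q = y →
      (mulFun x y : A ⧸ N) = N.mkQ (p *[M] q) := by
    intro x y p q hp hq hx hy
    have h₁ : rep x - p ∈ N := (Submodule.Quotient.eq N).1 ((mk_rep x).trans hx.symm)
    have h₂ : rep y - q ∈ N := (Submodule.Quotient.eq N).1 ((mk_rep y).trans hy.symm)
    refine (Submodule.Quotient.eq N).2 ?_
    have : rep x *[M] rep y - p *[M] q
        = (rep x - p) *[M] rep y + p *[M] (rep y - q) := by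
      simp only [map_sub, LinearMap.sub_apply]; abel
    rw [this]
    exact N.add_mem (hr _ h₁ _ (rep_mem y)) (hl _ hp _ h₂)
  { mul := LinearMap.mk₂ k mulFun
      (fun x x' y => Subtype.ext <| by
        rw [key (x + x') y (rep x + rep x') (rep y) (T₀.add_mem (rep_mem x) (rep_mem x'))
          (rep_mem y) (by rw [map_add, mk_rep, mk_rep]; rfl) (mk_rep y)]
        simp [mulFun])
      (fun c x y => Subtype.ext <| by
        rw [key (c • x) y (c • rep x) (rep y) (T₀.smul_mem c (rep_mem x))
          (rep_mem y) (by rw [map_smul, mk_rep]; rfl) (mk_rep y)]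
        simp [mulFun])
      (fun x y y' => Subtype.ext <| by
        rw [key x (y + y') (rep x) (rep y + rep y') (rep_mem x)
          (T₀.add_mem (rep_mem y) (rep_mem y')) (mk_rep x)
          (by rw [map_add, mk_rep, mk_rep]; rfl)]
        simp [mulFun])
      (fun c x y => Subtype.ext <| by
        rw [key x (c • y) (rep x) (c • rep y) (rep_mem x)
          (T₀.smul_mem c (rep_mem y)) (mk_rep x) (by rw [map_smul, mk_rep]; rfl)]
        simp [mulFun])
    one := ⟨N.mkQ M.one, Submodule.mem_map_of_mem hone⟩
    mul_assoc := fun x y z => Subtype.ext <| by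
      change (mulFun (mulFun x y) z : A ⧸ N) = mulFun x (mulFun y z)
      rw [key (mulFun x y) z (rep x *[M] rep y) (rep z) (hmul _ (rep_mem x) _ (rep_mem y))
        (rep_mem z) rfl (mk_rep z), key x (mulFun y z) (rep x) (rep y *[M] rep z) (rep_mem x)
        (hmul _ (rep_mem y) _ (rep_mem z)) (mk_rep x) rfl, M.mul_assoc]
    one_mul := fun x => Subtype.ext <| by
      change (mulFun _ x : A ⧸ N) = x
      rw [key _ x M.one (rep x) hone (rep_mem x) rfl (mk_rep x), M.one_mul, mk_rep]
    mul_one := fun x => Subtype.ext <| by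
      change (mulFun x _ : A ⧸ N) = x
      rw [key x _ (rep x) M.one (rep_mem x) hone (mk_rep x) rfl, M.mul_one, mk_rep] }

theorem subquot_mul (M : AlgStr k A) (N T₀ : Submodule k A)
    (hone : M.one ∈ T₀) (hmul : ∀ p ∈ T₀, ∀ q ∈ T₀, p *[M] q ∈ T₀)
    (hl : ∀ p ∈ T₀, ∀ q ∈ N, p *[M] q ∈ N) (hr : ∀ p ∈ N, ∀ q ∈ T₀, p *[M] q ∈ N)
    (x y : T₀.map N.mkQ) (p q : A) (hp : p ∈ T₀) (_hq : q ∈ T₀)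
    (hx : N.mkQ p = x) (hy : N.mkQ q = y) :
    ((x *[M.subquot N T₀ hone hmul hl hr] y : T₀.map N.mkQ) : A ⧸ N) = N.mkQ (p *[M] q) := by
  have h₁ : ((Submodule.mem_map).1 x.2).choose - p ∈ N := (Submodule.Quotient.eq N).1
    (((Submodule.mem_map).1 x.2).choose_spec.2.trans hx.symm)
  have h₂ : ((Submodule.mem_map).1 y.2).choose - q ∈ N := (Submodule.Quotient.eq N).1
    (((Submodule.mem_map).1 y.2).choose_spec.2.trans hy.symm)
  refine (Submodule.Quotient.eq N).2 ?_
  have : ((Submodule.mem_map).1 x.2).choose *[M] ((Submodule.mem_map).1 y.2).choose - p *[M] q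
      = (((Submodule.mem_map).1 x.2).choose - p) *[M] ((Submodule.mem_map).1 y.2).choose
        + p *[M] (((Submodule.mem_map).1 y.2).choose - q) := by
    simp only [map_sub, LinearMap.sub_apply]; abel
  rw [this]
  exact N.add_mem (hr _ h₁ _ ((Submodule.mem_map).1 y.2).choose_spec.1) (hl _ hp _ h₂)

/-- The elements `p` of `A ⊗[k] A` with `p (t x ⊗ 1) = p (1 ⊗ s x)` modulo `N` for all `x ∈ X`,
where the products are termwise products in `M`. -/
def preLeftTakeuchi (M : AlgStr k A) (X : Submodule k A) (s t : A →ₗ[k] A)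
    (N : Submodule k (A ⊗[k] A)) : Submodule k (A ⊗[k] A) where
  carrier := {p | ∀ x ∈ X, N.mkQ (p *[M.tensor] (t x ⊗ₜ[k] M.one))
    = N.mkQ (p *[M.tensor] (M.one ⊗ₜ[k] s x))}
  add_mem' hp hq x hx := by
    simp only [map_add, LinearMap.add_apply, hp x hx, hq x hx]
  zero_mem' x hx := by simp
  smul_mem' c p hp x hx := by
    simp only [map_smul, LinearMap.smul_apply, hp x hx]

/-- The elements `p` of `A ⊗[k] A` with `(s x ⊗ 1) p = (1 ⊗ t x) p` modulo `N` for all `x ∈ X`,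
where the products are termwise products in `M`. -/
def preRightTakeuchi (M : AlgStr k A) (X : Submodule k A) (s t : A →ₗ[k] A)
    (N : Submodule k (A ⊗[k] A)) : Submodule k (A ⊗[k] A) where
  carrier := {p | ∀ x ∈ X, N.mkQ ((s x ⊗ₜ[k] M.one) *[M.tensor] p)
    = N.mkQ ((M.one ⊗ₜ[k] t x) *[M.tensor] p)}
  add_mem' hp hq x hx := by
    simp only [map_add, hp x hx, hq x hx]
  zero_mem' x hx := by simp
  smul_mem' c p hp x hx := by
    simp only [map_smul, hp x hx]

/-- The Takeuchi product of a left bialgebroid with source `s` and target `t` on `X`: the elements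
`∑ a ⊗ a'` of `A ⊗_X A = (A ⊗[k] A) ⧸ N` such that `∑ a (t x) ⊗ a' = ∑ a ⊗ a' (s x)` for all
`x ∈ X`. -/
def leftTakeuchi (M : AlgStr k A) (X : Submodule k A) (s t : A →ₗ[k] A)
    (N : Submodule k (A ⊗[k] A)) : Submodule k ((A ⊗[k] A) ⧸ N) :=
  (M.preLeftTakeuchi X s t N).map N.mkQ

/-- The Takeuchi product of a right bialgebroid with source `s` and target `t` on `X`: the elements
`∑ a ⊗ a'` of `A ⊗_X A = (A ⊗[k] A) ⧸ N` such that `∑ (s x) a ⊗ a' = ∑ a ⊗ (t x) a'` for all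
`x ∈ X`. -/
def rightTakeuchi (M : AlgStr k A) (X : Submodule k A) (s t : A →ₗ[k] A)
    (N : Submodule k (A ⊗[k] A)) : Submodule k ((A ⊗[k] A) ⧸ N) :=
  (M.preRightTakeuchi X s t N).map N.mkQ

/-- The relations of the bimodule structure `x · a · x' = s x (t x' a)` of a left bialgebroid. -/
def leftRel (M : AlgStr k A) (X : Submodule k A) (s t : A →ₗ[k] A) :
    Submodule k (A ⊗[k] A) :=
  Submodule.span k {p | ∃ a a' : A, ∃ x ∈ X,
    p = (t x *[M] a) ⊗ₜ[k] a' - a ⊗ₜ[k] (s x *[M] a')}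

/-- The relations of the bimodule structure `x · a · x' = (a t x) s x'` of a right bialgebroid. -/
def rightRel (M : AlgStr k A) (X : Submodule k A) (s t : A →ₗ[k] A) :
    Submodule k (A ⊗[k] A) :=
  Submodule.span k {p | ∃ a a' : A, ∃ x ∈ X,
    p = (a *[M] s x) ⊗ₜ[k] a' - a ⊗ₜ[k] (a' *[M] t x)}

theorem leftRel_mul (M : AlgStr k A) (X : Submodule k A) (s t : A →ₗ[k] A)
    {p : A ⊗[k] A} (hp : p ∈ M.leftRel X s t) (q : A ⊗[k] A) :
    p *[M.tensor] q ∈ M.leftRel X s t := by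
  induction q using TensorProduct.induction_on with
  | zero => simp
  | add x y hx hy => rw [map_add]; exact Submodule.add_mem _ hx hy
  | tmul c c' =>
    have : M.leftRel X s t ≤ (M.leftRel X s t).comap (M.tensor.mul.flip (c ⊗ₜ[k] c')) := by
      refine Submodule.span_le.2 ?_
      rintro _ ⟨a, a', x, hx, rfl⟩
      refine Submodule.subset_span ⟨a *[M] c, a' *[M] c', x, hx, ?_⟩
      simp [tensor_mul_tmul, M.mul_assoc]
    exact this hp

theorem mul_rightRel (M : AlgStr k A) (X : Submodule k A) (s t : A →ₗ[k] A)
    {p : A ⊗[k] A} (hp : p ∈ M.rightRel X s t) (q : A ⊗[k] A) :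
    q *[M.tensor] p ∈ M.rightRel X s t := by
  induction q using TensorProduct.induction_on with
  | zero => simp
  | add x y hx hy => rw [map_add]; exact Submodule.add_mem _ hx hy
  | tmul c c' =>
    have : M.rightRel X s t ≤ (M.rightRel X s t).comap (M.tensor.mul (c ⊗ₜ[k] c')) := by
      refine Submodule.span_le.2 ?_
      rintro _ ⟨a, a', x, hx, rfl⟩
      refine Submodule.subset_span ⟨c *[M] a, c' *[M] a', x, hx, ?_⟩
      simp [tensor_mul_tmul, M.mul_assoc]
    exact this hp

theorem preLeftTakeuchi_mul_leftRel (M : AlgStr k A) (X : Submodule k A) (s t : A →ₗ[k] A)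
    {p q : A ⊗[k] A} (hp : p ∈ M.preLeftTakeuchi X s t (M.leftRel X s t))
    (hq : q ∈ M.leftRel X s t) : p *[M.tensor] q ∈ M.leftRel X s t := by
  have : M.leftRel X s t ≤ (M.leftRel X s t).comap (M.tensor.mul p) := by
    refine Submodule.span_le.2 ?_
    rintro _ ⟨a, a', x, hx, rfl⟩
    have h := M.leftRel_mul X s t ((Submodule.Quotient.eq _).1 (hp x hx)) (a ⊗ₜ[k] a')
    simpa [M.tensor.mul_assoc, tensor_mul_tmul, M.one_mul] using h
  exact this hq

theorem rightRel_mul_preRightTakeuchi (M : AlgStr k A) (X : Submodule k A) (s t : A →ₗ[k] A)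
    {p q : A ⊗[k] A} (hp : p ∈ M.rightRel X s t)
    (hq : q ∈ M.preRightTakeuchi X s t (M.rightRel X s t)) :
    p *[M.tensor] q ∈ M.rightRel X s t := by
  have : M.rightRel X s t ≤ (M.rightRel X s t).comap (M.tensor.mul.flip q) := by
    refine Submodule.span_le.2 ?_
    rintro _ ⟨a, a', x, hx, rfl⟩
    have h := M.mul_rightRel X s t ((Submodule.Quotient.eq _).1 (hq x hx)) (a ⊗ₜ[k] a')
    simpa [← M.tensor.mul_assoc, tensor_mul_tmul, M.mul_one] using h
  exact this hp

theorem mk_mem_leftTakeuchi (M : AlgStr k A) (X : Submodule k A) (s t : A →ₗ[k] A)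
    (N : Submodule k (A ⊗[k] A)) (hN : N = M.leftRel X s t) (p : A ⊗[k] A) :
    N.mkQ p ∈ M.leftTakeuchi X s t N ↔ ∀ x ∈ X,
      N.mkQ (p *[M.tensor] (t x ⊗ₜ[k] M.one)) = N.mkQ (p *[M.tensor] (M.one ⊗ₜ[k] s x)) := by
  refine ⟨?_, fun h => Submodule.mem_map_of_mem h⟩
  rintro ⟨q, hq, hqp⟩ x hx
  have h : ∀ r, N.mkQ (q *[M.tensor] r) = N.mkQ (p *[M.tensor] r) := fun r => by
    refine (Submodule.Quotient.eq _).2 ?_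
    have h₁ : q - p ∈ N := (Submodule.Quotient.eq _).1 hqp
    subst hN
    have h₂ := M.leftRel_mul X s t h₁ r
    rwa [map_sub, LinearMap.sub_apply] at h₂
  rw [← h, ← h]
  exact hq x hx

theorem mk_mem_rightTakeuchi (M : AlgStr k A) (X : Submodule k A) (s t : A →ₗ[k] A)
    (N : Submodule k (A ⊗[k] A)) (hN : N = M.rightRel X s t) (p : A ⊗[k] A) :
    N.mkQ p ∈ M.rightTakeuchi X s t N ↔ ∀ x ∈ X,
      N.mkQ ((s x ⊗ₜ[k] M.one) *[M.tensor] p) = N.mkQ ((M.one ⊗ₜ[k] t x) *[M.tensor] p) := by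
  refine ⟨?_, fun h => Submodule.mem_map_of_mem h⟩
  rintro ⟨q, hq, hqp⟩ x hx
  have h : ∀ r, N.mkQ (r *[M.tensor] q) = N.mkQ (r *[M.tensor] p) := fun r => by
    refine (Submodule.Quotient.eq _).2 ?_
    have h₁ : q - p ∈ N := (Submodule.Quotient.eq _).1 hqp
    subst hN
    have h₂ := M.mul_rightRel X s t h₁ r
    rwa [map_sub] at h₂
  rw [← h, ← h]
  exact hq x hx

/-- The algebra structure of the left Takeuchi product, with termwise multiplication in `M`. -/
noncomputable def leftTakeuchiAlg (M : AlgStr k A) (X : Submodule k A) (s t : A →ₗ[k] A)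
    (N : Submodule k (A ⊗[k] A)) (hN : N = M.leftRel X s t) :
    AlgStr k (M.leftTakeuchi X s t N) :=
  M.tensor.subquot N (M.preLeftTakeuchi X s t N)
    (by
      subst hN
      intro x hx
      simp only [M.tensor.one_mul]
      refine (Submodule.Quotient.eq _).2 (Submodule.subset_span ⟨M.one, M.one, x, hx, ?_⟩)
      simp [M.mul_one])
    (by
      subst hN
      intro p hp q hq x hx
      refine (Submodule.Quotient.eq _).2 ?_
      have h := M.preLeftTakeuchi_mul_leftRel X s t hp
        ((Submodule.Quotient.eq _).1 (hq x hx))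
      simpa [M.tensor.mul_assoc] using h)
    (by subst hN; exact fun p hp q hq => M.preLeftTakeuchi_mul_leftRel X s t hp hq)
    (by subst hN; exact fun p hp q _ => M.leftRel_mul X s t hp q)

/-- The algebra structure of the right Takeuchi product, with termwise multiplication in `M`. -/
noncomputable def rightTakeuchiAlg (M : AlgStr k A) (X : Submodule k A) (s t : A →ₗ[k] A)
    (N : Submodule k (A ⊗[k] A)) (hN : N = M.rightRel X s t) :
    AlgStr k (M.rightTakeuchi X s t N) :=
  M.tensor.subquot N (M.preRightTakeuchi X s t N)
    (by
      subst hN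
      intro x hx
      simp only [M.tensor.mul_one]
      refine (Submodule.Quotient.eq _).2 (Submodule.subset_span ⟨M.one, M.one, x, hx, ?_⟩)
      simp [M.one_mul])
    (by
      subst hN
      intro p hp q hq x hx
      refine (Submodule.Quotient.eq _).2 ?_
      have h := M.rightRel_mul_preRightTakeuchi X s t
        ((Submodule.Quotient.eq _).1 (hp x hx)) hq
      simpa [M.tensor.mul_assoc] using h)
    (by subst hN; exact fun p _ q hq => M.mul_rightRel X s t hq p)
    (by subst hN; exact fun p hp q hq => M.rightRel_mul_preRightTakeuchi X s t hp hq)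

end

end AlgStr

/-! ### Double algebras -/

/-- A double algebra on the `k`-module `A`: the vertical algebra `V` (product `∘`, unit `e`) and the
horizontal algebra `H` (product `⋆`, unit `i`), subject to the eight axioms. -/
structure DoubleAlgebra (k A : Type*) [CommRing k] [AddCommGroup A] [Module k A] where
  V : AlgStr k A
  H : AlgStr k A
  A1 : ∀ a b, (a *[H] V.one) *[V] b = ((a *[H] V.one) *[V] H.one) *[H] b
  A2 : ∀ a b, a *[V] (b *[H] V.one) = (H.one *[V] (b *[H] V.one)) *[H] a
  A3 : ∀ a b, (a *[V] H.one) *[H] b = ((a *[V] H.one) *[H] V.one) *[V] b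
  A4 : ∀ a b, a *[H] (b *[V] H.one) = (V.one *[H] (b *[V] H.one)) *[V] a
  A5 : ∀ a b, a *[V] (V.one *[H] b) = a *[H] (H.one *[V] (V.one *[H] b))
  A6 : ∀ a b, (V.one *[H] a) *[V] b = b *[H] ((V.one *[H] a) *[V] H.one)
  A7 : ∀ a b, a *[H] (H.one *[V] b) = a *[V] (V.one *[H] (H.one *[V] b))
  A8 : ∀ a b, (H.one *[V] a) *[H] b = b *[V] ((H.one *[V] a) *[H] V.one)

namespace DoubleAlgebra

section

variable {k A : Type*} [CommRing k] [AddCommGroup A] [Module k A] (D : DoubleAlgebra k A)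

/-- `φ_L a = a ⋆ e`. -/
def phiL : A →ₗ[k] A := D.H.mul.flip D.V.one

/-- `φ_R a = e ⋆ a`. -/
def phiR : A →ₗ[k] A := D.H.mul D.V.one

/-- `φ_B a = a ∘ i`. -/
def phiB : A →ₗ[k] A := D.V.mul.flip D.H.one

/-- `φ_T a = i ∘ a`. -/
def phiT : A →ₗ[k] A := D.V.mul D.H.one

/-- The base algebra `L = φ_L(A)`. -/
def L : Submodule k A := LinearMap.range D.phiL

/-- The base algebra `R = φ_R(A)`. -/
def R : Submodule k A := LinearMap.range D.phiR

/-- The base algebra `B = φ_B(A)`. -/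
def B : Submodule k A := LinearMap.range D.phiB

/-- The base algebra `T = φ_T(A)`. -/
def T : Submodule k A := LinearMap.range D.phiT

/-- A double algebra is Frobenius if its four base maps are Frobenius homomorphisms. -/
structure IsFrobenius : Prop where
  frobL : D.V.IsFrobeniusHom D.L D.phiL
  frobR : D.V.IsFrobeniusHom D.R D.phiR
  frobB : D.H.IsFrobeniusHom D.B D.phiB
  frobT : D.H.IsFrobeniusHom D.T D.phiT

variable {D} in
/-- `Δ_L : A → A ⊗_L A`. -/
noncomputable def IsFrobenius.deltaL (hF : D.IsFrobenius) : A → D.V.BalTensor D.L := hF.frobL.comul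

variable {D} in
/-- `Δ_R : A → A ⊗_R A`. -/
noncomputable def IsFrobenius.deltaR (hF : D.IsFrobenius) : A → D.V.BalTensor D.R := hF.frobR.comul

variable {D} in
/-- `Δ_B : A → A ⊗_B A`. -/
noncomputable def IsFrobenius.deltaB (hF : D.IsFrobenius) : A → D.H.BalTensor D.B := hF.frobB.comul

variable {D} in
/-- `Δ_T : A → A ⊗_T A`. -/
noncomputable def IsFrobenius.deltaT (hF : D.IsFrobenius) : A → D.H.BalTensor D.T := hF.frobT.comul

/-- An antipode of the double algebra. -/
structure IsAntipode (S : A →ₗ[k] A) : Prop where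
  antiB : ∀ a a' a'', D.phiB (a' *[D.H] (a'' *[D.V] a)) = D.phiB ((a' *[D.V] S a) *[D.H] a'')
  antiR : ∀ a a' a'', D.phiR (a' *[D.V] (a *[D.H] a'')) = D.phiR ((S a *[D.H] a') *[D.V] a'')
  antiL : ∀ a a' a'', D.phiL ((a' *[D.H] a) *[D.V] a'') = D.phiL (a' *[D.V] (a'' *[D.H] S a))
  antiT : ∀ a a' a'', D.phiT ((a *[D.V] a') *[D.H] a'') = D.phiT (a' *[D.H] (S a *[D.V] a''))

/-! The base algebras act on `A` in two ways. -/

theorem L_vmul {l : A} (hl : l ∈ D.L) (a : A) : l *[D.V] a = D.phiB l *[D.H] a := by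
  obtain ⟨c, rfl⟩ := hl; exact D.A1 c a

theorem vmul_L {l : A} (hl : l ∈ D.L) (a : A) : a *[D.V] l = D.phiT l *[D.H] a := by
  obtain ⟨c, rfl⟩ := hl; exact D.A2 a c

theorem B_hmul {b : A} (hb : b ∈ D.B) (a : A) : b *[D.H] a = D.phiL b *[D.V] a := by
  obtain ⟨c, rfl⟩ := hb; exact D.A3 c a

theorem hmul_B {b : A} (hb : b ∈ D.B) (a : A) : a *[D.H] b = D.phiR b *[D.V] a := by
  obtain ⟨c, rfl⟩ := hb; exact D.A4 a c

theorem vmul_R {r : A} (hr : r ∈ D.R) (a : A) : a *[D.V] r = a *[D.H] D.phiT r := by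
  obtain ⟨c, rfl⟩ := hr; exact D.A5 a c

theorem R_vmul {r : A} (hr : r ∈ D.R) (a : A) : r *[D.V] a = a *[D.H] D.phiB r := by
  obtain ⟨c, rfl⟩ := hr; exact D.A6 c a

theorem hmul_T {t : A} (ht : t ∈ D.T) (a : A) : a *[D.H] t = a *[D.V] D.phiR t := by
  obtain ⟨c, rfl⟩ := ht; exact D.A7 a c

theorem T_hmul {t : A} (ht : t ∈ D.T) (a : A) : t *[D.H] a = a *[D.V] D.phiL t := by
  obtain ⟨c, rfl⟩ := ht; exact D.A8 c a

/-! ### Distributivity -/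

/-- The map `A ⊗_B A → A`, `x ⊗ y ↦ (x ∘ a') ⋆ (y ∘ a'')`. -/
def distB (a' a'' : A) : D.H.BalTensor D.B →ₗ[k] A :=
  D.H.btlift D.B (D.H.mul.compl₁₂ (D.V.mul.flip a') (D.V.mul.flip a'')) (by
    intro x y b hb
    change ((x *[D.H] b) *[D.V] a') *[D.H] (y *[D.V] a'')
      = (x *[D.V] a') *[D.H] ((b *[D.H] y) *[D.V] a'')
    rw [D.hmul_B hb x, D.B_hmul hb y, D.V.mul_assoc, D.V.mul_assoc, ← D.hmul_B hb,
      ← D.B_hmul hb, D.H.mul_assoc])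

/-- The map `A ⊗_L A → A`, `x ⊗ y ↦ (x ⋆ a') ∘ (y ⋆ a'')`. -/
def distL (a' a'' : A) : D.V.BalTensor D.L →ₗ[k] A :=
  D.V.btlift D.L (D.V.mul.compl₁₂ (D.H.mul.flip a') (D.H.mul.flip a'')) (by
    intro x y b hb
    change ((x *[D.V] b) *[D.H] a') *[D.V] (y *[D.H] a'')
      = (x *[D.H] a') *[D.V] ((b *[D.V] y) *[D.H] a'')
    rw [D.vmul_L hb x, D.L_vmul hb y, D.H.mul_assoc, D.H.mul_assoc, ← D.vmul_L hb,
      ← D.L_vmul hb, D.V.mul_assoc])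

/-- The map `A ⊗_T A → A`, `x ⊗ y ↦ (a' ∘ x) ⋆ (a'' ∘ y)`. -/
def distT (a' a'' : A) : D.H.BalTensor D.T →ₗ[k] A :=
  D.H.btlift D.T (D.H.mul.compl₁₂ (D.V.mul a') (D.V.mul a'')) (by
    intro x y b hb
    change (a' *[D.V] (x *[D.H] b)) *[D.H] (a'' *[D.V] y)
      = (a' *[D.V] x) *[D.H] (a'' *[D.V] (b *[D.H] y))
    rw [D.hmul_T hb x, D.T_hmul hb y, ← D.V.mul_assoc, ← D.V.mul_assoc, ← D.hmul_T hb,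
      ← D.T_hmul hb, D.H.mul_assoc])

/-- The map `A ⊗_R A → A`, `x ⊗ y ↦ (a' ⋆ x) ∘ (a'' ⋆ y)`. -/
def distR (a' a'' : A) : D.V.BalTensor D.R →ₗ[k] A :=
  D.V.btlift D.R (D.V.mul.compl₁₂ (D.H.mul a') (D.H.mul a'')) (by
    intro x y b hb
    change (a' *[D.H] (x *[D.V] b)) *[D.V] (a'' *[D.H] y)
      = (a' *[D.H] x) *[D.V] (a'' *[D.H] (b *[D.V] y))
    rw [D.vmul_R hb x, D.R_vmul hb y, ← D.H.mul_assoc, ← D.H.mul_assoc, ← D.vmul_R hb,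
      ← D.R_vmul hb, D.V.mul_assoc])

variable {D} in
/-- Distributivity of a Frobenius double algebra:
`a ∘ (a' ⋆ a'') = (a₍₁₎ ∘ a') ⋆ (a₍₂₎ ∘ a'')` with `Δ_B a = a₍₁₎ ⊗ a₍₂₎`, and its three variants. -/
structure IsFrobenius.IsDistributive (hF : D.IsFrobenius) : Prop where
  distB : ∀ a a' a'', a *[D.V] (a' *[D.H] a'') = D.distB a' a'' (hF.deltaB a)
  distL : ∀ a a' a'', a *[D.H] (a' *[D.V] a'') = D.distL a' a'' (hF.deltaL a)
  distT : ∀ a a' a'', (a' *[D.H] a'') *[D.V] a = D.distT a' a'' (hF.deltaT a)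
  distR : ∀ a a' a'', (a' *[D.V] a'') *[D.H] a = D.distR a' a'' (hF.deltaR a)

/-! ### The four Takeuchi products -/

theorem balRel_B : D.H.balRel D.B = D.V.leftRel D.B D.phiL D.phiR := by
  refine congrArg (Submodule.span k) (Set.ext fun p => ?_)
  refine exists_congr fun a => exists_congr fun a' => exists_congr fun x =>
    and_congr_right fun hx => ?_
  rw [D.hmul_B hx, D.B_hmul hx]

theorem balRel_L : D.V.balRel D.L = D.H.leftRel D.L D.phiB D.phiT := by
  refine congrArg (Submodule.span k) (Set.ext fun p => ?_)
  refine exists_congr fun a => exists_congr fun a' => exists_congr fun x =>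
    and_congr_right fun hx => ?_
  rw [D.vmul_L hx, D.L_vmul hx]

theorem balRel_T : D.H.balRel D.T = D.V.rightRel D.T D.phiR D.phiL := by
  refine congrArg (Submodule.span k) (Set.ext fun p => ?_)
  refine exists_congr fun a => exists_congr fun a' => exists_congr fun x =>
    and_congr_right fun hx => ?_
  rw [D.hmul_T hx, D.T_hmul hx]

theorem balRel_R : D.V.balRel D.R = D.H.rightRel D.R D.phiT D.phiB := by
  refine congrArg (Submodule.span k) (Set.ext fun p => ?_)
  refine exists_congr fun a => exists_congr fun a' => exists_congr fun x =>
    and_congr_right fun hx => ?_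
  rw [D.vmul_R hx, D.R_vmul hx]

/-- `V ×_B V`: the elements `∑ a ⊗ a'` of `A ⊗_B A` with
`∑ a ∘ φ_R b ⊗ a' = ∑ a ⊗ a' ∘ φ_L b` for all `b ∈ B`. -/
def takeuchiB : Submodule k (D.H.BalTensor D.B) :=
  D.V.leftTakeuchi D.B D.phiL D.phiR (D.H.balRel D.B)

/-- `H ×_L H`: the elements `∑ a ⊗ a'` of `A ⊗_L A` with
`∑ a ⋆ φ_T l ⊗ a' = ∑ a ⊗ a' ⋆ φ_B l` for all `l ∈ L`. -/
def takeuchiL : Submodule k (D.V.BalTensor D.L) :=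
  D.H.leftTakeuchi D.L D.phiB D.phiT (D.V.balRel D.L)

/-- `V ×_T V`: the elements `∑ a ⊗ a'` of `A ⊗_T A` with
`∑ φ_R t ∘ a ⊗ a' = ∑ a ⊗ φ_L t ∘ a'` for all `t ∈ T`. -/
def takeuchiT : Submodule k (D.H.BalTensor D.T) :=
  D.V.rightTakeuchi D.T D.phiR D.phiL (D.H.balRel D.T)

/-- `H ×_R H`: the elements `∑ a ⊗ a'` of `A ⊗_R A` with
`∑ φ_T r ⋆ a ⊗ a' = ∑ a ⊗ φ_B r ⋆ a'` for all `r ∈ R`. -/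
def takeuchiR : Submodule k (D.V.BalTensor D.R) :=
  D.H.rightTakeuchi D.R D.phiT D.phiB (D.V.balRel D.R)

/-- The algebra `V ×_B V`, with termwise vertical multiplication. -/
noncomputable def takeuchiAlgB : AlgStr k D.takeuchiB :=
  D.V.leftTakeuchiAlg D.B D.phiL D.phiR (D.H.balRel D.B) D.balRel_B

/-- The algebra `H ×_L H`, with termwise horizontal multiplication. -/
noncomputable def takeuchiAlgL : AlgStr k D.takeuchiL :=
  D.H.leftTakeuchiAlg D.L D.phiB D.phiT (D.V.balRel D.L) D.balRel_L

/-- The algebra `V ×_T V`, with termwise vertical multiplication. -/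
noncomputable def takeuchiAlgT : AlgStr k D.takeuchiT :=
  D.V.rightTakeuchiAlg D.T D.phiR D.phiL (D.H.balRel D.T) D.balRel_T

/-- The algebra `H ×_R H`, with termwise horizontal multiplication. -/
noncomputable def takeuchiAlgR : AlgStr k D.takeuchiR :=
  D.H.rightTakeuchiAlg D.R D.phiT D.phiB (D.V.balRel D.R) D.balRel_R

variable {D} in
/-- The four comultiplications are algebra homomorphisms `Δ_B : V → V ×_B V`, `Δ_L : H → H ×_L H`,
`Δ_T : V → V ×_T V` and `Δ_R : H → H ×_R H`; in particular they take values there. -/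
structure IsFrobenius.ComulAlgHom (hF : D.IsFrobenius) : Prop where
  homB : ∃ f : A →ₗ[k] D.takeuchiB,
    (∀ a, (f a : D.H.BalTensor D.B) = hF.deltaB a) ∧ D.V.IsAlgHom D.takeuchiAlgB f
  homL : ∃ f : A →ₗ[k] D.takeuchiL,
    (∀ a, (f a : D.V.BalTensor D.L) = hF.deltaL a) ∧ D.H.IsAlgHom D.takeuchiAlgL f
  homT : ∃ f : A →ₗ[k] D.takeuchiT,
    (∀ a, (f a : D.H.BalTensor D.T) = hF.deltaT a) ∧ D.V.IsAlgHom D.takeuchiAlgT f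
  homR : ∃ f : A →ₗ[k] D.takeuchiR,
    (∀ a, (f a : D.V.BalTensor D.R) = hF.deltaR a) ∧ D.H.IsAlgHom D.takeuchiAlgR f

end

end DoubleAlgebra

/-! The quarter turn `rot` replaces (V, H) by (Hᵒᵖ, V) and permutes the four base maps cyclically.
The conditions attached to R, T, L are therefore the B-conditions of the first three rotations, and
it suffices to argue with `DistributesB`, `AntipodalB` and `ComulBMultiplicative`. Two tools carry
the computations: the contractions x ⊗ y ↦ x φ(yc) separate the points of A ⊗_X A (`contract_ext`),
and the Casimir identity (`sum_casimir`) moves a factor across the dual bases. Below, u, v are dual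
bases of φ_B and x₍₁₎ ⊗ x₍₂₎ = ∑ x ⋆ uⱼ ⊗ vⱼ.

Distributivity gives multiplicativity: contract Δ_B(a) ∘ Δ_B(b) with c, expand (vᵢ ∘ vⱼ) ⋆ c by the
law for R, move a factor by Casimir, and collapse by the law for B. The B-axiom for an antipode
forces S(a) = ∑ φ_B(e ⋆ (uⱼ ∘ a)) ⋆ vⱼ; multiplicativity of Δ_B shows that this formula works, and
nondegeneracy of φ_B identifies the maps obtained from consecutive rotations.

Conversely, an antipode reverses both products. Multiplicativity of Δ_B gives S(x₍₁₎) ∘ x₍₂₎ = φ_R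
φ_B S(x), hence (x₍₁₎ ∘ y) ⋆ x₍₂₎ = x ∘ φ_L(y), hence the distributive law after applying φ_B
(`sum_phiB`). The Takeuchi condition is the law with last factor in B (`sum_hmul_B`). Writing y ⋆ z
= ∑ (y ⋆ uₗ) ⋆ φ_B(vₗ ⋆ z) reduces the full law to these two (`distributesB`). -/

namespace AlgStr

/-! ### Opposite algebras, Casimir elements and separating contractions -/

section

variable {k A A' : Type*} [CommRing k] [AddCommGroup A] [Module k A]
  [AddCommGroup A'] [Module k A']

/-- The opposite algebra. -/
def op (M : AlgStr k A) : AlgStr k A where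
  mul := M.mul.flip
  one := M.one
  mul_assoc a b c := (M.mul_assoc c b a).symm
  one_mul := M.mul_one
  mul_one := M.one_mul

theorem sum_mul (M : AlgStr k A) {ι : Type*} (s : Finset ι) (f : ι → A) (a : A) :
    (∑ i ∈ s, f i) *[M] a = ∑ i ∈ s, f i *[M] a := by
  simp only [map_sum, LinearMap.sum_apply]

theorem mul_sum (M : AlgStr k A) {ι : Type*} (s : Finset ι) (a : A) (f : ι → A) :
    a *[M] (∑ i ∈ s, f i) = ∑ i ∈ s, a *[M] f i := map_sum _ _ _

theorem op_isDualBasis {M : AlgStr k A} {φ : A →ₗ[k] A} {n : ℕ} {x y : Fin n → A} :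
    M.op.IsDualBasis φ x y ↔ M.IsDualBasis φ y x :=
  ⟨fun h => ⟨h.sum_right, h.sum_left⟩, fun h => ⟨h.sum_right, h.sum_left⟩⟩

theorem IsFrobeniusHom.op {M : AlgStr k A} {X : Submodule k A} {φ : A →ₗ[k] A}
    (h : M.IsFrobeniusHom X φ) : M.op.IsFrobeniusHom X φ where
  one_mem := h.one_mem
  mul_mem x hx y hy := h.mul_mem y hy x hx
  map_mem := h.map_mem
  map_left := h.map_right
  map_right := h.map_left
  exists_dualBasis := by
    obtain ⟨n, x, y, hxy⟩ := h.exists_dualBasis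
    exact ⟨n, y, x, op_isDualBasis.2 hxy⟩

/-- The flip `A ⊗_X A → A ⊗_X A` to the tensor product for the opposite algebra. -/
def btflip (M : AlgStr k A) (X : Submodule k A) : M.BalTensor X →ₗ[k] M.op.BalTensor X :=
  M.btlift X ((TensorProduct.mk k A A).flip.compr₂ (M.op.balRel X).mkQ)
    fun a a' _ hx => (M.op.btmul_balanced X a' a hx).symm

theorem btflip_btmul (M : AlgStr k A) (X : Submodule k A) (a a' : A) :
    M.btflip X (M.btmul X a a') = M.op.btmul X a' a :=
  M.btlift_btmul X _ _ a a'

theorem btflip_btflip (M : AlgStr k A) (X : Submodule k A) (p : M.BalTensor X) :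
    M.op.btflip X (M.btflip X p) = p := by
  obtain ⟨p, rfl⟩ := (M.balRel X).mkQ_surjective p
  induction p using TensorProduct.induction_on with
  | zero => simp only [map_zero]; rfl
  | add p q hp hq => rw [map_add, map_add, map_add, hp, hq]; rfl
  | tmul a a' => exact (congrArg _ (M.btflip_btmul X a a')).trans (M.op.btflip_btmul X a' a)

theorem btflip_injective (M : AlgStr k A) (X : Submodule k A) :
    Function.Injective (M.btflip X) :=
  Function.LeftInverse.injective (M.btflip_btflip X)

theorem IsFrobeniusHom.map_mul_map {M : AlgStr k A} {X : Submodule k A} {φ : A →ₗ[k] A}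
    (h : M.IsFrobeniusHom X φ) (a b : A) : φ (φ a *[M] b) = φ a *[M] φ b :=
  h.map_left _ (h.map_mem a) b

/-- Nondegeneracy of φ: the expansion ∑ φ(a xⱼ) yⱼ recovers a. -/
theorem IsFrobeniusHom.ext_left {M : AlgStr k A} {X : Submodule k A} {φ : A →ₗ[k] A}
    (h : M.IsFrobeniusHom X φ) {a b : A} (hab : ∀ c, φ (a *[M] c) = φ (b *[M] c)) : a = b := by
  obtain ⟨n, x, y, hxy⟩ := h.exists_dualBasis
  rw [← hxy.sum_left a, ← hxy.sum_left b]
  simp only [hab]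

/-- The Casimir property of `∑ⱼ xⱼ ⊗ yⱼ`. -/
theorem IsDualBasis.sum_casimir {M : AlgStr k A} {X : Submodule k A} {φ : A →ₗ[k] A}
    (h : M.IsFrobeniusHom X φ) {n : ℕ} {x y : Fin n → A} (hxy : M.IsDualBasis φ x y)
    (f : A →ₗ[k] A →ₗ[k] A') (hf : ∀ a a', ∀ b ∈ X, f (a *[M] b) a' = f a (b *[M] a')) (c : A) :
    ∑ j, f (x j) (y j *[M] c) = ∑ j, f (c *[M] x j) (y j) := by
  -- Expand yⱼ c in the dual bases and push the coefficient, which lies in X, to the left; the sum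
  -- over j then collapses by the other expansion.
  have h₁ : ∀ j, f (x j) (y j *[M] c)
      = ∑ i, f (x j *[M] φ (y j *[M] (c *[M] x i))) (y i) := fun j => by
    conv_lhs => rw [← hxy.sum_left (y j *[M] c), map_sum]
    refine Finset.sum_congr rfl fun i _ => ?_
    rw [hf _ _ _ (h.map_mem _), M.mul_assoc]
  simp only [h₁]
  rw [Finset.sum_comm]
  refine Finset.sum_congr rfl fun i _ => ?_
  rw [← LinearMap.sum_apply, ← map_sum, hxy.sum_right]

theorem IsDualBasis.sum_btmul_casimir {M : AlgStr k A} {X : Submodule k A} {φ : A →ₗ[k] A}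
    (h : M.IsFrobeniusHom X φ) {n : ℕ} {x y : Fin n → A} (hxy : M.IsDualBasis φ x y) (c : A) :
    ∑ j, M.btmul X (x j) (y j *[M] c) = ∑ j, M.btmul X (c *[M] x j) (y j) :=
  hxy.sum_casimir h ((TensorProduct.mk k A A).compr₂ (M.balRel X).mkQ)
    (fun a a' _ hx => M.btmul_balanced X a a' hx) c

/-- The map `A ⊗_X A → A`, `x ⊗ y ↦ x φ(y c)`. -/
def IsFrobeniusHom.contract {M : AlgStr k A} {X : Submodule k A} {φ : A →ₗ[k] A}
    (h : M.IsFrobeniusHom X φ) (c : A) : M.BalTensor X →ₗ[k] A :=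
  M.btlift X (M.mul.compl₂ (φ ∘ₗ M.mul.flip c)) (by
    intro a a' b hb
    change (a *[M] b) *[M] φ (a' *[M] c) = a *[M] φ ((b *[M] a') *[M] c)
    rw [M.mul_assoc b, h.map_left b hb, M.mul_assoc])

theorem IsFrobeniusHom.contract_btmul {M : AlgStr k A} {X : Submodule k A} {φ : A →ₗ[k] A}
    (h : M.IsFrobeniusHom X φ) (c a a' : A) :
    h.contract c (M.btmul X a a') = a *[M] φ (a' *[M] c) :=
  M.btlift_btmul X _ _ a a'

theorem IsFrobeniusHom.contract_ext {M : AlgStr k A} {X : Submodule k A} {φ : A →ₗ[k] A}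
    (h : M.IsFrobeniusHom X φ) {p q : M.BalTensor X}
    (hpq : ∀ c, h.contract c p = h.contract c q) : p = q := by
  obtain ⟨n, x, y, hxy⟩ := h.exists_dualBasis
  -- The contractions against the finitely many xⱼ already reconstruct p.
  have key : ∀ p : M.BalTensor X, ∑ j, M.btmul X (h.contract (x j) p) (y j) = p := by
    intro p
    obtain ⟨p, rfl⟩ := (M.balRel X).mkQ_surjective p
    induction p using TensorProduct.induction_on with
    | zero => simp [btmul]
    | add p q hp hq =>
      rw [map_add]
      conv_rhs => rw [← hp, ← hq]
      rw [← Finset.sum_add_distrib]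
      simp only [btmul, map_add, TensorProduct.add_tmul]
    | tmul a a' =>
      change ∑ j, M.btmul X (h.contract (x j) (M.btmul X a a')) (y j) = M.btmul X a a'
      simp only [h.contract_btmul, M.btmul_balanced X _ _ (h.map_mem _)]
      rw [← M.btmul_sum_right, hxy.sum_left]
  rw [← key p, ← key q]
  simp only [hpq]

end

end AlgStr

/-! ### Rotation of a double algebra and the B-forms of the conditions -/

namespace DoubleAlgebra

section

variable {k A : Type*} [CommRing k] [AddCommGroup A] [Module k A] (D : DoubleAlgebra k A)

/-- The double algebra rotated by a quarter turn: it has vertical algebra `Hᵒᵖ` and horizontal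
algebra `V`, and its base maps `φ_B`, `φ_R`, `φ_T`, `φ_L` are `φ_R`, `φ_T`, `φ_L`, `φ_B`. -/
def rot : DoubleAlgebra k A where
  V := D.H.op
  H := D.V
  A1 a b := D.A4 b a
  A2 a b := D.A3 b a
  A3 a b := D.A6 a b
  A4 a b := D.A5 a b
  A5 a b := D.A8 b a
  A6 a b := D.A7 b a
  A7 a b := D.A2 a b
  A8 a b := D.A1 a b

variable {D} in
theorem IsFrobenius.rot (hF : D.IsFrobenius) : D.rot.IsFrobenius where
  frobL := hF.frobB.op
  frobR := hF.frobT.op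
  frobB := hF.frobR
  frobT := hF.frobL

-- Rotation permutes the four axioms cyclically, so the same S serves; a' and a'' trade places where
-- a product is reversed.
variable {D} in
theorem IsAntipode.rot {S : A →ₗ[k] A} (hS : D.IsAntipode S) : D.rot.IsAntipode S where
  antiB a a' a'' := hS.antiR a a' a''
  antiR a a' a'' := hS.antiT a a'' a'
  antiL a a' a'' := hS.antiB a a'' a'
  antiT a a' a'' := hS.antiL a a' a''

theorem phiL_mem (a : A) : D.phiL a ∈ D.L := LinearMap.mem_range_self _ a
theorem phiR_mem (a : A) : D.phiR a ∈ D.R := LinearMap.mem_range_self _ a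
theorem phiB_mem (a : A) : D.phiB a ∈ D.B := LinearMap.mem_range_self _ a
theorem phiT_mem (a : A) : D.phiT a ∈ D.T := LinearMap.mem_range_self _ a

theorem phiB_phiL {b : A} (hb : b ∈ D.B) : D.phiB (D.phiL b) = b :=
  (D.B_hmul hb D.H.one).symm.trans (D.H.mul_one b)

theorem phiB_phiR {b : A} (hb : b ∈ D.B) : D.phiB (D.phiR b) = b :=
  (D.hmul_B hb D.H.one).symm.trans (D.H.one_mul b)

theorem phiR_phiB {r : A} (hr : r ∈ D.R) : D.phiR (D.phiB r) = r :=
  (D.R_vmul hr D.V.one).symm.trans (D.V.mul_one r)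

theorem phiT_phiL {t : A} (ht : t ∈ D.T) : D.phiT (D.phiL t) = t :=
  (D.T_hmul ht D.H.one).symm.trans (D.H.mul_one t)

/-- Both ⋆-actions of B are left ∘-multiplications, by φ_L b and by φ_R b, so they commute with
right ∘-multiplication. -/
theorem B_hmul_vmul {b : A} (hb : b ∈ D.B) (a c : A) :
    (b *[D.H] a) *[D.V] c = b *[D.H] (a *[D.V] c) := by
  rw [D.B_hmul hb, D.B_hmul hb, D.V.mul_assoc]

theorem hmul_B_vmul {b : A} (hb : b ∈ D.B) (a c : A) :
    (a *[D.H] b) *[D.V] c = (a *[D.V] c) *[D.H] b := by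
  rw [D.hmul_B hb, D.hmul_B hb, D.V.mul_assoc]

theorem phiB_vmul (a b : A) : D.phiB (a *[D.V] b) = a *[D.V] D.phiB b := D.V.mul_assoc a b _

/-- The distributive law `a ∘ (a' ⋆ a'') = (a₍₁₎ ∘ a') ⋆ (a₍₂₎ ∘ a'')` for `Δ_B`. -/
def DistributesB : Prop :=
  ∀ (n : ℕ) (u v : Fin n → A), D.H.IsDualBasis D.phiB u v → ∀ a a' a'' : A,
    a *[D.V] (a' *[D.H] a'')
      = ∑ j, ((a *[D.H] u j) *[D.V] a') *[D.H] (v j *[D.V] a'')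

/-- `Δ_B` takes values in `V ×_B V` and is multiplicative. -/
structure ComulBMultiplicative : Prop where
  mul : ∀ (n : ℕ) (u v : Fin n → A), D.H.IsDualBasis D.phiB u v → ∀ a b : A,
    ∑ j, D.H.btmul D.B ((a *[D.V] b) *[D.H] u j) (v j)
      = ∑ i, ∑ j, D.H.btmul D.B ((a *[D.H] u i) *[D.V] (b *[D.H] u j)) (v i *[D.V] v j)
  takeuchi : ∀ (n : ℕ) (u v : Fin n → A), D.H.IsDualBasis D.phiB u v → ∀ a, ∀ b ∈ D.B,
    ∑ j, D.H.btmul D.B ((a *[D.H] u j) *[D.V] D.phiR b) (v j)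
      = ∑ j, D.H.btmul D.B (a *[D.H] u j) (v j *[D.V] D.phiL b)

/-- The antipode axiom for `φ_B`. -/
def AntipodalB (S : A →ₗ[k] A) : Prop :=
  ∀ a a' a'', D.phiB (a' *[D.H] (a'' *[D.V] a)) = D.phiB ((a' *[D.V] S a) *[D.H] a'')

end

end DoubleAlgebra

namespace DoubleAlgebra

section

variable {k A : Type*} [CommRing k] [AddCommGroup A] [Module k A] {D : DoubleAlgebra k A}

open AlgStr

/-! ### Distributivity implies that the comultiplications are multiplicative -/

theorem DistributesB.phiB_hmul_vmul {D : DoubleAlgebra k A} {m : ℕ} {w z : Fin m → A}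
    (hwz : D.V.IsDualBasis D.phiR w z) (hR : D.rot.DistributesB) (a b c : A) :
    D.phiB ((a *[D.V] b) *[D.H] c)
      = ∑ l, (a *[D.H] (c *[D.V] w l)) *[D.V] D.phiB (b *[D.H] z l) := by
  have h : (a *[D.V] b) *[D.H] c
      = ∑ l, (a *[D.H] (c *[D.V] w l)) *[D.V] (b *[D.H] z l) := hR m w z hwz c a b
  rw [h, map_sum]
  simp only [phiB_vmul]

/-- After contraction with c both sides become (a ∘ b) ⋆ c; the R-law opens the product inside φ_B
and also reassembles the result. -/
theorem DistributesB.comul_vmul (hF : D.IsFrobenius) (hB : D.DistributesB)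
    (hR : D.rot.DistributesB) {n : ℕ} {u v : Fin n → A} (huv : D.H.IsDualBasis D.phiB u v)
    (a b : A) :
    ∑ j, D.H.btmul D.B ((a *[D.V] b) *[D.H] u j) (v j)
      = ∑ i, ∑ j, D.H.btmul D.B ((a *[D.H] u i) *[D.V] (b *[D.H] u j)) (v i *[D.V] v j) := by
  obtain ⟨m, w, z, hwz⟩ := hF.frobR.exists_dualBasis
  refine hF.frobB.contract_ext fun c => ?_
  simp only [map_sum, hF.frobB.contract_btmul]
  simp only [DistributesB.phiB_hmul_vmul hwz hR]
  have hl : ∑ j, ((a *[D.V] b) *[D.H] u j) *[D.H] D.phiB (v j *[D.H] c)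
      = (a *[D.V] b) *[D.H] c := by
    simp only [D.H.mul_assoc]
    rw [← D.H.mul_sum, huv.sum_right]
  -- Casimir carries c ∘ wₗ from vᵢ to the left of uᵢ; what remains is the B-law for a ⋆ (c ∘ wₗ).
  have hmove : ∀ l j, ∑ i, ((a *[D.H] u i) *[D.V] (b *[D.H] u j)) *[D.H]
        ((v i *[D.H] (c *[D.V] w l)) *[D.V] D.phiB (v j *[D.H] z l))
      = (a *[D.H] (c *[D.V] w l)) *[D.V] ((b *[D.H] u j) *[D.H] D.phiB (v j *[D.H] z l)) := by
    intro l j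
    rw [hB n u v huv]
    refine (huv.sum_casimir hF.frobB (D.H.mul.compl₁₂ (D.V.mul.flip (b *[D.H] u j) ∘ₗ D.H.mul a)
      (D.V.mul.flip (D.phiB (v j *[D.H] z l)))) ?_ _).trans ?_
    · intro x y β hβ
      change ((a *[D.H] (x *[D.H] β)) *[D.V] _) *[D.H] (y *[D.V] _)
        = ((a *[D.H] x) *[D.V] _) *[D.H] ((β *[D.H] y) *[D.V] _)
      rw [← D.H.mul_assoc, D.hmul_B_vmul hβ, D.B_hmul_vmul hβ, D.H.mul_assoc]
    · refine Finset.sum_congr rfl fun i _ => ?_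
      change ((a *[D.H] ((c *[D.V] w l) *[D.H] u i)) *[D.V] _) *[D.H] (v i *[D.V] _) = _
      rw [← D.H.mul_assoc a]
  rw [hl, show (a *[D.V] b) *[D.H] c
      = ∑ l, (a *[D.H] (c *[D.V] w l)) *[D.V] (b *[D.H] z l) from hR m w z hwz c a b]
  simp only [D.H.mul_sum]
  rw [Finset.sum_comm]
  symm
  refine (Finset.sum_congr rfl fun j _ => Finset.sum_comm.trans
    (Finset.sum_congr rfl fun l _ => hmove l j)).trans ?_
  rw [Finset.sum_comm]
  refine Finset.sum_congr rfl fun l _ => ?_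
  simp only [D.H.mul_assoc]
  rw [← D.V.mul_sum, ← D.H.mul_sum, huv.sum_right]

theorem phiB_vmul_L_hmul {l : A} (hl : l ∈ D.L) (a c : A) :
    D.phiB ((a *[D.V] l) *[D.H] c) = (a *[D.H] c) *[D.V] D.phiB l := by
  rw [D.vmul_L hl, D.H.mul_assoc, ← D.vmul_L hl, phiB_vmul]

/-- Contracted with c, both sides equal (a ⋆ c) ∘ φ_R b; on the right this is the B-law with a' = e
and a'' = b. -/
theorem DistributesB.comul_mem_takeuchi (hF : D.IsFrobenius) (hB : D.DistributesB)
    {n : ℕ} {u v : Fin n → A} (huv : D.H.IsDualBasis D.phiB u v) (a : A) {b : A} (hb : b ∈ D.B) :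
    ∑ j, D.H.btmul D.B ((a *[D.H] u j) *[D.V] D.phiR b) (v j)
      = ∑ j, D.H.btmul D.B (a *[D.H] u j) (v j *[D.V] D.phiL b) := by
  refine hF.frobB.contract_ext fun c => ?_
  simp only [map_sum, hF.frobB.contract_btmul]
  have hl : ∀ j, ((a *[D.H] u j) *[D.V] D.phiR b) *[D.H] D.phiB (v j *[D.H] c)
      = (a *[D.H] (u j *[D.H] D.phiB (v j *[D.H] c))) *[D.V] D.phiR b := fun j => by
    rw [← D.H.mul_assoc, ← D.hmul_B_vmul (D.phiB_mem _)]
  simp only [hl, phiB_vmul_L_hmul (D.phiL_mem b), D.phiB_phiL hb]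
  rw [← D.V.sum_mul, ← D.H.mul_sum, huv.sum_right]
  symm
  refine (huv.sum_casimir hF.frobB (D.H.mul.compl₁₂ (D.H.mul a) (D.V.mul.flip b)) ?_ c).trans ?_
  · intro x y β hβ
    change (a *[D.H] (x *[D.H] β)) *[D.H] (y *[D.V] b)
      = (a *[D.H] x) *[D.H] ((β *[D.H] y) *[D.V] b)
    rw [D.B_hmul_vmul hβ]
    simp only [D.H.mul_assoc]
  · have h := hB n u v huv (a *[D.H] c) D.V.one b
    simp only [D.V.mul_one] at h
    refine Eq.trans (Finset.sum_congr rfl fun j _ => ?_) h.symm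
    change (a *[D.H] (c *[D.H] u j)) *[D.H] (v j *[D.V] b) = _
    simp only [D.H.mul_assoc]

theorem DistributesB.comulBMultiplicative (hF : D.IsFrobenius) (hB : D.DistributesB)
    (hR : D.rot.DistributesB) : D.ComulBMultiplicative where
  mul _ _ _ huv a b := hB.comul_vmul hF hR huv a b
  takeuchi _ _ _ huv a _ hb := hB.comul_mem_takeuchi hF huv a hb

/-! ### Distributivity implies the existence of an antipode -/

/-- The sum multiplied by a' on the left is the value at a of the antipode to be constructed; the
identity says that ∘-multiplying it by a' replaces e by a' in the formula. -/
theorem DistributesB.vmul_antipode (hF : D.IsFrobenius) (hB : D.DistributesB)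
    (hR : D.rot.DistributesB) {n : ℕ} {u v : Fin n → A} (huv : D.H.IsDualBasis D.phiB u v)
    (a a' : A) :
    a' *[D.V] (∑ j, D.phiB (D.V.one *[D.H] (u j *[D.V] a)) *[D.H] v j)
      = ∑ j, D.phiB (a' *[D.H] (u j *[D.V] a)) *[D.H] v j := by
  -- The B-law is used twice, on the outer product and inside φ_B; Casimir then turns uᵢ ⋆ uₗ ⊗ vₗ
  -- into uₗ ⊗ vₗ ⋆ uᵢ.
  have h₁ : ∀ j, a' *[D.V] (D.phiB (D.V.one *[D.H] (u j *[D.V] a)) *[D.H] v j)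
      = ∑ l, ∑ i, D.phiB (a' *[D.H] (u l *[D.H] ((v l *[D.H] u i) *[D.V] (u j *[D.V] a))))
          *[D.H] (v i *[D.V] v j) := by
    intro j
    have h₂ : ∀ i, (a' *[D.H] u i) *[D.V] D.phiB (D.V.one *[D.H] (u j *[D.V] a))
        = ∑ l, D.phiB (a' *[D.H] ((u i *[D.H] u l) *[D.H] (v l *[D.V] (u j *[D.V] a)))) := by
      intro i
      rw [← phiB_vmul, hB n u v huv, map_sum]
      simp only [D.V.mul_one, D.H.mul_assoc]
    rw [hB n u v huv, Finset.sum_comm]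
    refine Finset.sum_congr rfl fun i _ => ?_
    rw [h₂, ← D.H.sum_mul]
    refine congrArg (fun c => c *[D.H] (v i *[D.V] v j)) ?_
    refine (huv.sum_casimir hF.frobB (D.H.mul.compl₁₂ LinearMap.id (D.V.mul.flip (u j *[D.V] a))
      |>.compr₂ (D.phiB ∘ₗ D.H.mul a')) ?_ (u i)).symm
    intro x y β hβ
    change D.phiB (a' *[D.H] ((x *[D.H] β) *[D.H] (y *[D.V] _)))
      = D.phiB (a' *[D.H] (x *[D.H] ((β *[D.H] y) *[D.V] _)))
    rw [D.B_hmul_vmul hβ, D.H.mul_assoc]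
  rw [D.V.mul_sum]
  simp only [h₁]
  rw [Finset.sum_comm]
  -- For fixed l this is a balanced map evaluated at Δ_B(vₗ) ∘ Δ_B(i) = Δ_B(vₗ ∘ i) = Δ_B(φ_B vₗ).
  -- Summing over l later uses ∑ uₗ ⋆ φ_B(vₗ) = i.
  have h₃ : ∀ l, ∑ j, ∑ i, D.phiB (a' *[D.H] (u l *[D.H] ((v l *[D.H] u i) *[D.V] (u j *[D.V] a))))
          *[D.H] (v i *[D.V] v j)
      = ∑ j, D.phiB (a' *[D.H] ((u l *[D.H] D.phiB (v l)) *[D.H] (u j *[D.V] a))) *[D.H] v j := by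
    intro l
    let f : A →ₗ[k] A →ₗ[k] A :=
      D.H.mul ∘ₗ (D.phiB ∘ₗ D.H.mul a' ∘ₗ D.H.mul (u l) ∘ₗ D.V.mul.flip a)
    have hf : ∀ x y, f x y = D.phiB (a' *[D.H] (u l *[D.H] (x *[D.V] a))) *[D.H] y :=
      fun x y => rfl
    have hbal : ∀ x y, ∀ β ∈ D.B, f (x *[D.H] β) y = f x (β *[D.H] y) := by
      intro x y β hβ
      rw [hf, hf, D.hmul_B_vmul hβ, ← D.H.mul_assoc, ← D.H.mul_assoc, hF.frobB.map_right β hβ,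
        D.H.mul_assoc, ← D.H.mul_assoc a']
    have h := congrArg (D.H.btlift D.B f hbal) (hB.comul_vmul hF hR huv (v l) D.H.one)
    simp only [map_sum, D.H.btlift_btmul, hf, D.H.one_mul, D.V.mul_assoc] at h
    rw [Finset.sum_comm, ← h]
    refine Finset.sum_congr rfl fun j _ => ?_
    change D.phiB (a' *[D.H] (u l *[D.H] ((D.phiB (v l) *[D.H] u j) *[D.V] a))) *[D.H] v j = _
    rw [D.B_hmul_vmul (D.phiB_mem _), D.H.mul_assoc (u l)]
  simp only [h₃]
  rw [Finset.sum_comm]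
  refine Finset.sum_congr rfl fun j _ => ?_
  have h := huv.sum_right D.H.one
  simp only [D.H.mul_one] at h
  rw [← D.H.sum_mul, ← map_sum, ← D.H.mul_sum, ← D.H.sum_mul, h, D.H.one_mul]

theorem DistributesB.exists_antipodalB (hF : D.IsFrobenius) (hB : D.DistributesB)
    (hR : D.rot.DistributesB) : ∃ S : A →ₗ[k] A, D.AntipodalB S := by
  obtain ⟨n, u, v, huv⟩ := hF.frobB.exists_dualBasis
  -- This formula is forced: the axiom with a' = e prescribes every φ_B(S a ⋆ uⱼ).
  refine ⟨∑ j, D.H.mul.flip (v j) ∘ₗ D.phiB ∘ₗ D.H.mul D.V.one ∘ₗ D.V.mul (u j),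
    fun a a' a'' => ?_⟩
  have hS : (∑ j, D.H.mul.flip (v j) ∘ₗ D.phiB ∘ₗ D.H.mul D.V.one ∘ₗ D.V.mul (u j)) a
      = ∑ j, D.phiB (D.V.one *[D.H] (u j *[D.V] a)) *[D.H] v j := by
    simp only [LinearMap.sum_apply]; rfl
  have h : ∀ j, D.phiB ((D.phiB (a' *[D.H] (u j *[D.V] a)) *[D.H] v j) *[D.H] a'')
      = D.phiB (a' *[D.H] ((u j *[D.H] D.phiB (v j *[D.H] a'')) *[D.V] a)) := fun j => by
    rw [D.H.mul_assoc, hF.frobB.map_mul_map, D.hmul_B_vmul (D.phiB_mem _), ← D.H.mul_assoc a',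
      hF.frobB.map_right _ (D.phiB_mem _)]
  rw [hS, hB.vmul_antipode hF hR huv, D.H.sum_mul, map_sum]
  simp only [h]
  rw [← map_sum, ← D.H.mul_sum, ← D.V.sum_mul, huv.sum_right]

theorem AntipodalB.phiB_hmul {S : A →ₗ[k] A} (hS : D.AntipodalB S) (a c : A) :
    D.phiB (S a *[D.H] c) = D.phiB (D.phiR (c *[D.V] a)) := by
  have h := hS a D.V.one c
  rw [D.V.one_mul] at h
  exact h.symm

/-- Both maps give φ_B(– ⋆ c) the value φ_B φ_R(c ∘ a), because φ_B φ_R is the identity on B;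
nondegeneracy of φ_B concludes. -/
theorem AntipodalB.eq_rot (hF : D.IsFrobenius) {S S' : A →ₗ[k] A} (hS : D.AntipodalB S)
    (hS' : D.rot.AntipodalB S') : S' = S := by
  refine LinearMap.ext fun a => hF.frobB.ext_left fun c => ?_
  have h : D.phiR (c *[D.V] (a *[D.H] D.H.one)) = D.phiR (D.phiB (S' a *[D.H] c)) :=
    hS' a c D.H.one
  rw [hS.phiB_hmul, ← D.H.mul_one a, h, D.phiB_phiR (D.phiB_mem _), D.H.mul_one]

theorem exists_isAntipode (hF : D.IsFrobenius) (hB : D.DistributesB)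
    (hR : D.rot.DistributesB) (hT : D.rot.rot.DistributesB) (hL : D.rot.rot.rot.DistributesB) :
    ∃ S : A →ₗ[k] A, D.IsAntipode S := by
  obtain ⟨S, hS⟩ := hB.exists_antipodalB hF hR
  obtain ⟨S₁, hS₁⟩ := hR.exists_antipodalB hF.rot hT
  obtain ⟨S₂, hS₂⟩ := hT.exists_antipodalB hF.rot.rot hL
  -- Four quarter turns restore `D` definitionally, so `hB` is also the law of the fourth rotation.
  obtain ⟨S₃, hS₃⟩ := hL.exists_antipodalB hF.rot.rot.rot hB
  obtain rfl := hS.eq_rot hF hS₁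
  obtain rfl := hS₁.eq_rot hF.rot hS₂
  obtain rfl := hS₂.eq_rot hF.rot.rot hS₃
  exact ⟨S₃, hS, hS₁, fun a a' a'' => hS₃ a a'' a', fun a a' a'' => hS₂ a a'' a'⟩

/-! ### Properties of the antipode -/

/-- Under φ_B, a right factor a ∘ b can be transferred at once or one factor at a time;
nondegeneracy compares the results. -/
theorem IsAntipode.map_vmul {S : A →ₗ[k] A} (hF : D.IsFrobenius) (hS : D.IsAntipode S) (a b : A) :
    S (a *[D.V] b) = S b *[D.V] S a := by
  refine hF.frobB.ext_left fun c => ?_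
  have h := hS.antiB (a *[D.V] b) D.V.one c
  rw [← D.V.mul_assoc, hS.antiB, hS.antiB] at h
  simpa only [D.V.one_mul] using h.symm

theorem IsAntipode.map_vone {S : A →ₗ[k] A} (hF : D.IsFrobenius) (hS : D.IsAntipode S) :
    S D.V.one = D.V.one := by
  refine hF.frobB.ext_left fun c => ?_
  have h := hS.antiB D.V.one D.V.one c
  simpa only [D.V.one_mul, D.V.mul_one] using h.symm

theorem IsAntipode.map_hmul {S : A →ₗ[k] A} (hF : D.IsFrobenius) (hS : D.IsAntipode S) (a b : A) :
    S (a *[D.H] b) = S b *[D.H] S a :=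
  hS.rot.map_vmul hF.rot b a

theorem IsAntipode.map_hone {S : A →ₗ[k] A} (hF : D.IsFrobenius) (hS : D.IsAntipode S) :
    S D.H.one = D.H.one :=
  hS.rot.map_vone hF.rot

theorem IsAntipode.map_phiB {S : A →ₗ[k] A} (hF : D.IsFrobenius) (hS : D.IsAntipode S) (a : A) :
    S (D.phiB a) = D.phiT (S a) := by
  change S (a *[D.V] D.H.one) = D.H.one *[D.V] S a
  rw [hS.map_vmul hF, hS.map_hone hF]

theorem IsAntipode.map_phiT {S : A →ₗ[k] A} (hF : D.IsFrobenius) (hS : D.IsAntipode S) (a : A) :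
    S (D.phiT a) = D.phiB (S a) := by
  change S (D.H.one *[D.V] a) = S a *[D.V] D.H.one
  rw [hS.map_vmul hF, hS.map_hone hF]

/-- The L-axiom at the units e and i, combined with φ_B φ_R = id on B. -/
theorem IsAntipode.phiL_map {S : A →ₗ[k] A} (hS : D.IsAntipode S) {b : A} (hb : b ∈ D.B) :
    D.phiL (S b) = D.phiL b := by
  have h := hS.antiL b D.V.one D.H.one
  rw [D.V.one_mul, D.H.one_mul] at h
  rw [← h]
  exact congrArg D.phiL (D.phiB_phiR hb)

theorem IsAntipode.phiR_vmul {S : A →ₗ[k] A} (hS : D.IsAntipode S) (a c : A) :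
    D.phiR (S a *[D.V] c) = D.phiR (D.phiT (a *[D.H] c)) := by
  have h := hS.antiR a D.H.one c
  rw [D.H.mul_one] at h
  exact h.symm

theorem IsAntipode.phiR_map {S : A →ₗ[k] A} (hS : D.IsAntipode S) {t : A} (ht : t ∈ D.T) :
    D.phiR (S t) = D.phiR t := by
  have h := hS.phiR_vmul t D.V.one
  rw [D.V.mul_one] at h
  rw [h]
  exact congrArg D.phiR (D.phiT_phiL ht)

theorem IsAntipode.phiB_hmul {S : A →ₗ[k] A} (hS : D.IsAntipode S) (a c : A) :
    D.phiB (S a *[D.H] c) = D.phiB (D.phiR (c *[D.V] a)) := by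
  have h := hS.antiB a D.V.one c
  rw [D.V.one_mul] at h
  exact h.symm

/-- This makes x ⊗ y ↦ S(x) ∘ y well defined on A ⊗_B A, since S maps B into T and φ_L S = φ_L on B.
-/
theorem IsAntipode.map_hmul_B_vmul {S : A →ₗ[k] A} (hF : D.IsFrobenius) (hS : D.IsAntipode S)
    {b : A} (hb : b ∈ D.B) (x y : A) :
    S (x *[D.H] b) *[D.V] y = S x *[D.V] (b *[D.H] y) := by
  have hSb : S b ∈ D.T := by
    obtain ⟨c, rfl⟩ := hb
    exact (hS.map_phiB hF c).symm ▸ D.phiT_mem _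
  rw [hS.map_hmul hF, D.T_hmul hSb, hS.phiL_map hb, D.B_hmul hb, D.V.mul_assoc]

/-! ### An antipode and multiplicative comultiplications imply distributivity -/

variable {S : A →ₗ[k] A} {n : ℕ} {u v : Fin n → A}

/-- `S(x₍₁₎) ∘ x₍₂₎ = φ_R φ_B S x`. -/
theorem IsAntipode.sum_map_vmul (hF : D.IsFrobenius) (hS : D.IsAntipode S)
    (hC : D.ComulBMultiplicative) (huv : D.H.IsDualBasis D.phiB u v) (x : A) :
    ∑ j, S (x *[D.H] u j) *[D.V] v j = D.phiR (D.phiB (S x)) := by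
  let f : A →ₗ[k] A →ₗ[k] A := D.H.mul ∘ₗ (D.phiB ∘ₗ D.phiR)
  have hf : ∀ x y, f x y = D.phiB (D.phiR x) *[D.H] y := fun _ _ => rfl
  have hbal : ∀ x y, ∀ b ∈ D.B, f (x *[D.H] b) y = f x (b *[D.H] y) := by
    intro x y b hb
    have : D.phiR (x *[D.H] b) = D.phiR x *[D.H] b := (D.H.mul_assoc _ _ _).symm
    rw [hf, hf, this, hF.frobB.map_right b hb, D.H.mul_assoc]
  -- The balanced map x ⊗ y ↦ φ_B φ_R(x) ⋆ y is applied to Δ_B(S x ∘ i) = Δ_B(S x) ∘ Δ_B(i); one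
  -- side collapses to φ_R φ_B(S x).
  have h := congrArg (D.H.btlift D.B f hbal) (hC.mul n u v huv (S x) D.H.one)
  simp only [map_sum, D.H.btlift_btmul, hf, D.H.one_mul, ← hS.phiB_hmul] at h
  rw [Finset.sum_comm] at h
  have hl : ∀ j, D.phiR ((S x *[D.V] D.H.one) *[D.H] u j) = D.phiR (D.phiB (S x)) *[D.H] u j :=
    fun j => (D.H.mul_assoc _ _ _).symm
  simp only [hl] at h
  rw [huv.sum_left] at h
  rw [h]
  refine Finset.sum_congr rfl fun j _ => ?_
  simp only [← D.B_hmul_vmul (D.phiB_mem _), ← D.H.mul_assoc]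
  rw [← D.V.sum_mul, huv.sum_left, hS.map_hmul hF]

theorem IsAntipode.sum_map_vmul_hmul (hF : D.IsFrobenius) (hS : D.IsAntipode S)
    (hC : D.ComulBMultiplicative) (huv : D.H.IsDualBasis D.phiB u v) (x c : A) :
    ∑ j, S (x *[D.H] u j) *[D.V] (v j *[D.H] c) = D.phiR (D.phiB (S (x *[D.H] c))) := by
  rw [← hS.sum_map_vmul hF hC huv]
  refine (huv.sum_casimir hF.frobB (D.V.mul.compl₁₂ (S ∘ₗ D.H.mul x) LinearMap.id) ?_ c).trans ?_
  · intro y z b hb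
    change S (x *[D.H] (y *[D.H] b)) *[D.V] z = S (x *[D.H] y) *[D.V] (b *[D.H] z)
    rw [← D.H.mul_assoc, hS.map_hmul_B_vmul hF hb]
  · refine Finset.sum_congr rfl fun j _ => ?_
    change S (x *[D.H] (c *[D.H] u j)) *[D.V] v j = _
    rw [D.H.mul_assoc]

/-- `(x₍₁₎ ∘ y) ⋆ x₍₂₎ = x ∘ φ_L y`. -/
theorem IsAntipode.sum_vmul_hmul (hF : D.IsFrobenius) (hS : D.IsAntipode S)
    (hC : D.ComulBMultiplicative) (huv : D.H.IsDualBasis D.phiB u v) (x y : A) :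
    ∑ j, ((x *[D.H] u j) *[D.V] y) *[D.H] v j = x *[D.V] D.phiL y := by
  -- Testing with φ_T lets the T-axiom replace left ∘-multiplication by x with S(x) on the other
  -- factor, where S(x₍₁₎) ∘ (x₍₂₎ ⋆ c) is known.
  refine hF.frobT.ext_left fun c => ?_
  have hr : D.phiT ((x *[D.V] D.phiL y) *[D.H] c)
      = D.phiT (y *[D.H] D.phiR (S x *[D.V] c)) := by
    change D.phiT ((x *[D.V] (y *[D.H] D.V.one)) *[D.H] c) = _
    rw [hS.antiT, D.H.mul_assoc]
    rfl
  rw [hr, hS.phiR_vmul, ← hS.phiR_map (D.phiT_mem _), hS.map_phiT hF,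
    ← hS.sum_map_vmul_hmul hF hC huv, D.H.sum_mul, map_sum, D.H.mul_sum, map_sum]
  simp only [D.H.mul_assoc (_ *[D.V] y), hS.antiT]

/-- `φ_B ((x₍₁₎ ∘ y) ⋆ (x₍₂₎ ∘ z)) = x ∘ φ_B (y ⋆ z)`. -/
theorem IsAntipode.sum_phiB (hF : D.IsFrobenius) (hS : D.IsAntipode S)
    (hC : D.ComulBMultiplicative) (huv : D.H.IsDualBasis D.phiB u v) (x y z : A) :
    ∑ j, D.phiB (((x *[D.H] u j) *[D.V] y) *[D.H] (v j *[D.V] z))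
      = x *[D.V] D.phiB (y *[D.H] z) := by
  have h := hS.antiB z y D.V.one
  rw [D.V.one_mul] at h
  -- The B-axiom trades z for S(z) beside y, so that `sum_vmul_hmul` applies to y ∘ S(z).
  simp only [hS.antiB z, D.V.mul_assoc]
  rw [← map_sum, hS.sum_vmul_hmul hF hC huv, phiB_vmul, h]
  rfl

theorem ComulBMultiplicative.sum_hmul_B
    (hC : D.ComulBMultiplicative) (huv : D.H.IsDualBasis D.phiB u v) (x y : A) {b : A}
    (hb : b ∈ D.B) :
    ∑ j, ((x *[D.H] u j) *[D.V] y) *[D.H] (v j *[D.V] b) = x *[D.V] (y *[D.H] b) := by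
  -- Taking a'' = i produces φ_B(vⱼ ∘ φ_L b) = vⱼ ∘ b on one side and φ_B(vⱼ), which sums away, on
  -- the other.
  have h := congrArg (D.distB y D.H.one) (hC.takeuchi n u v huv x b hb)
  simp only [map_sum, distB, D.H.btlift_btmul] at h
  change ∑ j, (((x *[D.H] u j) *[D.V] D.phiR b) *[D.V] y) *[D.H] D.phiB (v j)
    = ∑ j, ((x *[D.H] u j) *[D.V] y) *[D.H] D.phiB (v j *[D.V] D.phiL b) at h
  simp only [phiB_vmul, D.phiB_phiL hb] at h
  rw [← h]
  have h₁ := huv.sum_right D.H.one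
  simp only [D.H.mul_one] at h₁
  simp only [D.V.mul_assoc, ← D.hmul_B_vmul (D.phiB_mem _), D.H.mul_assoc]
  rw [← D.V.sum_mul, ← D.H.mul_sum, h₁, D.H.mul_one, D.hmul_B hb]

theorem IsAntipode.distributesB (hF : D.IsFrobenius) (hS : D.IsAntipode S)
    (hC : D.ComulBMultiplicative) : D.DistributesB := by
  intro n u v huv x y z
  have hyz : y *[D.H] z = ∑ i, (y *[D.H] u i) *[D.H] D.phiB (v i *[D.H] z) := by
    simp only [D.H.mul_assoc]
    rw [← D.H.mul_sum, huv.sum_right]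
  have hl : x *[D.V] (y *[D.H] z) = ∑ l, ∑ i, ∑ j, ((x *[D.H] u i) *[D.V] (y *[D.H] u l)) *[D.H]
      D.phiB (((v i *[D.H] u j) *[D.V] v l) *[D.H] (v j *[D.V] z)) := by
    rw [hyz, D.V.mul_sum]
    simp only [← hC.sum_hmul_B huv x _ (D.phiB_mem _), ← hS.sum_phiB hF hC huv, D.H.mul_sum]
  -- Multiplicativity of Δ_B at (x ⋆ uⱼ) ∘ y, contracted with vⱼ ∘ z.
  have hr : ∀ j, ((x *[D.H] u j) *[D.V] y) *[D.H] (v j *[D.V] z)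
      = ∑ l, ∑ i, ((x *[D.H] (u j *[D.H] u i)) *[D.V] (y *[D.H] u l)) *[D.H]
          D.phiB ((v i *[D.V] v l) *[D.H] (v j *[D.V] z)) := by
    intro j
    have h := congrArg (hF.frobB.contract (v j *[D.V] z)) (hC.mul n u v huv (x *[D.H] u j) y)
    simp only [map_sum, hF.frobB.contract_btmul] at h
    rw [Finset.sum_comm] at h
    simp only [D.H.mul_assoc] at h ⊢
    rw [← h, ← D.H.mul_sum, huv.sum_right]
  simp only [hl, hr]
  symm
  rw [Finset.sum_comm]
  refine Finset.sum_congr rfl fun l _ => ?_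
  symm
  rw [Finset.sum_comm]
  refine Finset.sum_congr rfl fun j _ => ?_
  -- The two expansions differ only by coassociativity of Δ_B: Casimir moves uⱼ from the right of vᵢ
  -- to the left of uᵢ.
  refine huv.sum_casimir hF.frobB (D.H.mul.compl₁₂ (D.V.mul.flip (y *[D.H] u l) ∘ₗ D.H.mul x)
    (D.phiB ∘ₗ D.H.mul.flip (v j *[D.V] z) ∘ₗ D.V.mul.flip (v l))) ?_ (u j)
  intro p q b hb
  change ((x *[D.H] (p *[D.H] b)) *[D.V] (y *[D.H] u l)) *[D.H]
      D.phiB ((q *[D.V] v l) *[D.H] (v j *[D.V] z))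
    = ((x *[D.H] p) *[D.V] (y *[D.H] u l)) *[D.H]
      D.phiB (((b *[D.H] q) *[D.V] v l) *[D.H] (v j *[D.V] z))
  rw [← D.H.mul_assoc x, D.hmul_B_vmul hb, D.B_hmul_vmul hb, D.H.mul_assoc b,
    hF.frobB.map_left b hb, D.H.mul_assoc]

end

end DoubleAlgebra

/-! ### Algebra homomorphisms into Takeuchi products, tested on representatives -/

namespace AlgStr

section

variable {k A E : Type*} [CommRing k] [AddCommGroup A] [Module k A]
  [AddCommGroup E] [Module k E]

/-- A linear map to the image of `T₀` in `P ⧸ N` that is represented by a linear map `F` to `P` is a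
homomorphism of algebras if and only if `F` takes values in `T₀` and is unital and multiplicative
modulo `N`. -/
theorem exists_isAlgHom_subquot_iff (M : AlgStr k A) (N T₀ : Submodule k A)
    (hone : M.one ∈ T₀) (hmul : ∀ p ∈ T₀, ∀ q ∈ T₀, p *[M] q ∈ T₀)
    (hl : ∀ p ∈ T₀, ∀ q ∈ N, p *[M] q ∈ N) (hr : ∀ p ∈ N, ∀ q ∈ T₀, p *[M] q ∈ N)
    (hN : N ≤ T₀) (M' : AlgStr k E) (F : E →ₗ[k] A) (Δ : E → A ⧸ N)
    (hF : ∀ a, Δ a = N.mkQ (F a)) :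
    (∃ f : E →ₗ[k] T₀.map N.mkQ, (∀ a, (f a : A ⧸ N) = Δ a) ∧
        M'.IsAlgHom (M.subquot N T₀ hone hmul hl hr) f) ↔
      (∀ a, F a ∈ T₀) ∧ N.mkQ (F M'.one) = N.mkQ M.one ∧
        ∀ a b, N.mkQ (F (a *[M'] b)) = N.mkQ (F a *[M] F b) := by
  constructor
  · rintro ⟨f, hf, hone', hmul'⟩
    have hmem : ∀ a, F a ∈ T₀ := by
      intro a
      obtain ⟨p, hp, hpa⟩ := (Submodule.mem_map).1 (f a).2
      rw [hf, hF] at hpa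
      have h := T₀.sub_mem hp (hN ((Submodule.Quotient.eq N).1 hpa))
      rwa [sub_sub_cancel] at h
    refine ⟨hmem, ?_, fun a b => ?_⟩
    · rw [← hF, ← hf, hone']
      rfl
    · rw [← hF, ← hf, hmul']
      exact M.subquot_mul N T₀ hone hmul hl hr _ _ _ _ (hmem a) (hmem b)
        (by rw [hf, hF]) (by rw [hf, hF])
  · rintro ⟨hmem, hone', hmul'⟩
    refine ⟨(N.mkQ ∘ₗ F).codRestrict _ fun a => Submodule.mem_map_of_mem (hmem a),
      fun a => (hF a).symm, Subtype.ext hone', fun a b => Subtype.ext ?_⟩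
    rw [M.subquot_mul N T₀ hone hmul hl hr _ _ _ _ (hmem a) (hmem b) rfl rfl]
    exact hmul' a b

/-- The relations form a right ideal, so both products vanish in the quotient; hence the Takeuchi
condition does not depend on the lift. -/
theorem leftRel_le_preLeftTakeuchi (M : AlgStr k A) (X : Submodule k A) (s t : A →ₗ[k] A) :
    M.leftRel X s t ≤ M.preLeftTakeuchi X s t (M.leftRel X s t) := by
  intro p hp x _
  rw [Submodule.mkQ_apply, Submodule.mkQ_apply,
    (Submodule.Quotient.mk_eq_zero _).2 (M.leftRel_mul X s t hp _),
    (Submodule.Quotient.mk_eq_zero _).2 (M.leftRel_mul X s t hp _)]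

theorem rightRel_le_preRightTakeuchi (M : AlgStr k A) (X : Submodule k A) (s t : A →ₗ[k] A) :
    M.rightRel X s t ≤ M.preRightTakeuchi X s t (M.rightRel X s t) := by
  intro p hp x _
  rw [Submodule.mkQ_apply, Submodule.mkQ_apply,
    (Submodule.Quotient.mk_eq_zero _).2 (M.mul_rightRel X s t hp _),
    (Submodule.Quotient.mk_eq_zero _).2 (M.mul_rightRel X s t hp _)]

theorem exists_isAlgHom_leftTakeuchi_iff (M : AlgStr k A) (X : Submodule k A)
    (s t : A →ₗ[k] A) (N : Submodule k (A ⊗[k] A)) (hN : N = M.leftRel X s t)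
    (M' : AlgStr k E) (F : E →ₗ[k] A ⊗[k] A) (Δ : E → (A ⊗[k] A) ⧸ N)
    (hF : ∀ a, Δ a = N.mkQ (F a)) :
    (∃ f : E →ₗ[k] M.leftTakeuchi X s t N, (∀ a, (f a : (A ⊗[k] A) ⧸ N) = Δ a) ∧
        M'.IsAlgHom (M.leftTakeuchiAlg X s t N hN) f) ↔
      (∀ a, F a ∈ M.preLeftTakeuchi X s t N) ∧ N.mkQ (F M'.one) = N.mkQ M.tensor.one ∧
        ∀ a b, N.mkQ (F (a *[M'] b)) = N.mkQ (F a *[M.tensor] F b) := by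
  unfold leftTakeuchiAlg
  refine M.tensor.exists_isAlgHom_subquot_iff N _ _ _ _ _ ?_ M' F Δ hF
  rw [hN]
  exact M.leftRel_le_preLeftTakeuchi X s t

theorem exists_isAlgHom_rightTakeuchi_iff (M : AlgStr k A) (X : Submodule k A)
    (s t : A →ₗ[k] A) (N : Submodule k (A ⊗[k] A)) (hN : N = M.rightRel X s t)
    (M' : AlgStr k E) (F : E →ₗ[k] A ⊗[k] A) (Δ : E → (A ⊗[k] A) ⧸ N)
    (hF : ∀ a, Δ a = N.mkQ (F a)) :
    (∃ f : E →ₗ[k] M.rightTakeuchi X s t N, (∀ a, (f a : (A ⊗[k] A) ⧸ N) = Δ a) ∧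
        M'.IsAlgHom (M.rightTakeuchiAlg X s t N hN) f) ↔
      (∀ a, F a ∈ M.preRightTakeuchi X s t N) ∧ N.mkQ (F M'.one) = N.mkQ M.tensor.one ∧
        ∀ a b, N.mkQ (F (a *[M'] b)) = N.mkQ (F a *[M.tensor] F b) := by
  unfold rightTakeuchiAlg
  refine M.tensor.exists_isAlgHom_subquot_iff N _ _ _ _ _ ?_ M' F Δ hF
  rw [hN]
  exact M.rightRel_le_preRightTakeuchi X s t

end

end AlgStr

namespace DoubleAlgebra

section

variable {k A : Type*} [CommRing k] [AddCommGroup A] [Module k A] {D : DoubleAlgebra k A}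

open AlgStr

/-! ### The conditions for the four comultiplications as rotations of the condition for `Δ_B` -/

theorem IsFrobenius.distB_iff (hF : D.IsFrobenius) :
    (∀ a a' a'', a *[D.V] (a' *[D.H] a'') = D.distB a' a'' (hF.deltaB a)) ↔ D.DistributesB := by
  have key : ∀ (n : ℕ) (u v : Fin n → A), D.H.IsDualBasis D.phiB u v → ∀ a a' a'',
      D.distB a' a'' (hF.deltaB a)
        = ∑ j, ((a *[D.H] u j) *[D.V] a') *[D.H] (v j *[D.V] a'') := by
    intro n u v huv a a' a''
    rw [deltaB, hF.frobB.comul_eq huv, map_sum]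
    exact Finset.sum_congr rfl fun j _ => D.H.btlift_btmul _ _ _ _ _
  constructor
  · intro h n u v huv a a' a''
    rw [h, key n u v huv]
  · intro h a a' a''
    obtain ⟨n, u, v, huv⟩ := hF.frobB.exists_dualBasis
    rw [key n u v huv, h n u v huv]

theorem IsFrobenius.distR_iff (hF : D.IsFrobenius) :
    (∀ a a' a'', (a' *[D.V] a'') *[D.H] a = D.distR a' a'' (hF.deltaR a)) ↔
      D.rot.DistributesB :=
  hF.rot.distB_iff

/-- The right-handed form of the comultiplication. -/
theorem _root_.AlgStr.IsFrobeniusHom.comul_eq_right {M : AlgStr k A} {X : Submodule k A}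
    {φ : A →ₗ[k] A} (h : M.IsFrobeniusHom X φ) {n : ℕ} {x y : Fin n → A}
    (hxy : M.IsDualBasis φ x y) (a : A) :
    h.comul a = ∑ j, M.btmul X (x j) (y j *[M] a) :=
  (h.comul_eq hxy a).trans (hxy.sum_btmul_casimir h a).symm

/-- The second rotation has horizontal algebra Hᵒᵖ, so its comultiplication is the right-handed form
∑ xⱼ ⊗ yⱼ ⋆ a with dual bases and tensor factors exchanged. -/
theorem IsFrobenius.distT_iff (hF : D.IsFrobenius) :
    (∀ a a' a'', (a' *[D.H] a'') *[D.V] a = D.distT a' a'' (hF.deltaT a)) ↔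
      D.rot.rot.DistributesB := by
  have key : ∀ (n : ℕ) (x y : Fin n → A), D.H.IsDualBasis D.phiT x y → ∀ a a' a'',
      D.distT a' a'' (hF.deltaT a)
        = ∑ j, (a' *[D.V] x j) *[D.H] (a'' *[D.V] (y j *[D.H] a)) := by
    intro n x y hxy a a' a''
    rw [deltaT, hF.frobT.comul_eq_right hxy, map_sum]
    exact Finset.sum_congr rfl fun j _ => D.H.btlift_btmul _ _ _ _ _
  constructor
  · intro h n u v huv a a' a''
    exact (h a a'' a').trans (key n v u (op_isDualBasis.1 huv) a a'' a')
  · intro h a a' a''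
    obtain ⟨n, x, y, hxy⟩ := hF.frobT.exists_dualBasis
    rw [key n x y hxy]
    exact h n y x (op_isDualBasis.2 hxy) a a'' a'

theorem IsFrobenius.distL_iff (hF : D.IsFrobenius) :
    (∀ a a' a'', a *[D.H] (a' *[D.V] a'') = D.distL a' a'' (hF.deltaL a)) ↔
      D.rot.rot.rot.DistributesB := by
  have key : ∀ (n : ℕ) (x y : Fin n → A), D.V.IsDualBasis D.phiL x y → ∀ a a' a'',
      D.distL a' a'' (hF.deltaL a)
        = ∑ j, (x j *[D.H] a') *[D.V] ((y j *[D.V] a) *[D.H] a'') := by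
    intro n x y hxy a a' a''
    rw [deltaL, hF.frobL.comul_eq_right hxy, map_sum]
    exact Finset.sum_congr rfl fun j _ => D.V.btlift_btmul _ _ _ _ _
  constructor
  · intro h n u v huv a a' a''
    exact (h a a'' a').trans (key n v u (op_isDualBasis.1 huv) a a'' a')
  · intro h a a' a''
    obtain ⟨n, x, y, hxy⟩ := hF.frobL.exists_dualBasis
    rw [key n x y hxy]
    exact h n y x (op_isDualBasis.2 hxy) a a'' a'

/-- `Δ_B e = e ⊗ e`. -/
theorem IsFrobenius.comulB_one (hF : D.IsFrobenius) {n : ℕ} {u v : Fin n → A}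
    (huv : D.H.IsDualBasis D.phiB u v) :
    ∑ j, D.H.btmul D.B (D.V.one *[D.H] u j) (v j) = D.H.btmul D.B D.V.one D.V.one := by
  refine hF.frobB.contract_ext fun c => ?_
  simp only [map_sum, hF.frobB.contract_btmul, D.H.mul_assoc]
  rw [← D.H.mul_sum, huv.sum_right]
  -- Contraction with c gives e ⋆ c = φ_R c on the left and φ_R φ_B φ_R c on the right.
  exact (D.phiR_phiB (D.phiR_mem c)).symm

/-- `ComulBMultiplicative` omits the unit condition because `comulB_one` holds in every Frobenius
double algebra. -/
theorem comulBMultiplicative_iff_of_forall {P : Prop} (hF : D.IsFrobenius)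
    (h : ∀ (n : ℕ) (u v : Fin n → A), D.H.IsDualBasis D.phiB u v → (P ↔
      (∀ a, ∀ b ∈ D.B, ∑ j, D.H.btmul D.B ((a *[D.H] u j) *[D.V] D.phiR b) (v j)
        = ∑ j, D.H.btmul D.B (a *[D.H] u j) (v j *[D.V] D.phiL b)) ∧
      (∑ j, D.H.btmul D.B (D.V.one *[D.H] u j) (v j) = D.H.btmul D.B D.V.one D.V.one) ∧
      ∀ a b, ∑ j, D.H.btmul D.B ((a *[D.V] b) *[D.H] u j) (v j)
        = ∑ i, ∑ j, D.H.btmul D.B ((a *[D.H] u i) *[D.V] (b *[D.H] u j)) (v i *[D.V] v j))) :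
    P ↔ D.ComulBMultiplicative := by
  constructor
  · intro hP
    exact ⟨fun n u v huv => ((h n u v huv).1 hP).2.2, fun n u v huv => ((h n u v huv).1 hP).1⟩
  · intro hC
    obtain ⟨n, u, v, huv⟩ := hF.frobB.exists_dualBasis
    exact (h n u v huv).2 ⟨hC.takeuchi n u v huv, hF.comulB_one huv, hC.mul n u v huv⟩

theorem IsFrobenius.homB_iff (hF : D.IsFrobenius) :
    (∃ f : A →ₗ[k] D.takeuchiB, (∀ a, (f a : D.H.BalTensor D.B) = hF.deltaB a) ∧
      D.V.IsAlgHom D.takeuchiAlgB f) ↔ D.ComulBMultiplicative := by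
  refine comulBMultiplicative_iff_of_forall hF fun n u v huv => ?_
  let F : A →ₗ[k] A ⊗[k] A :=
    ∑ j, (TensorProduct.mk k A A).flip (v j) ∘ₗ D.H.mul.flip (u j)
  have hFa : ∀ a, F a = ∑ j, (a *[D.H] u j) ⊗ₜ[k] v j := by
    intro a; simp only [F, LinearMap.sum_apply]; rfl
  refine (D.V.exists_isAlgHom_leftTakeuchi_iff _ _ _ _ D.balRel_B D.V F hF.deltaB
    (fun a => ?_)).trans (and_congr ?_ (and_congr ?_ ?_))
  · rw [hFa, map_sum]; exact hF.frobB.comul_eq huv a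
  · refine forall_congr' fun a => forall₂_congr fun b _ => ?_
    simp only [hFa, map_sum, LinearMap.sum_apply, tensor_mul_tmul, D.V.mul_one]
    rfl
  · rw [hFa, map_sum]; rfl
  · refine forall₂_congr fun a b => ?_
    simp only [hFa, map_sum, LinearMap.sum_apply, tensor_mul_tmul]
    rw [Finset.sum_comm]
    rfl

/-- The vertical algebra of the rotation is Hᵒᵖ: left and right Takeuchi products are exchanged, and
the two factors in the multiplicativity law are swapped. -/
theorem IsFrobenius.homR_iff (hF : D.IsFrobenius) :
    (∃ f : A →ₗ[k] D.takeuchiR, (∀ a, (f a : D.V.BalTensor D.R) = hF.deltaR a) ∧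
      D.H.IsAlgHom D.takeuchiAlgR f) ↔ D.rot.ComulBMultiplicative := by
  refine comulBMultiplicative_iff_of_forall hF.rot fun n u v huv => ?_
  let F : A →ₗ[k] A ⊗[k] A :=
    ∑ j, (TensorProduct.mk k A A).flip (v j) ∘ₗ D.V.mul.flip (u j)
  have hFa : ∀ a, F a = ∑ j, (a *[D.V] u j) ⊗ₜ[k] v j := by
    intro a; simp only [F, LinearMap.sum_apply]; rfl
  refine (D.H.exists_isAlgHom_rightTakeuchi_iff _ _ _ _ D.balRel_R D.H F hF.deltaR
    (fun a => ?_)).trans (and_congr ?_ (and_congr ?_ ?_))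
  · rw [hFa, map_sum]; exact hF.frobR.comul_eq huv a
  · refine forall_congr' fun a => forall₂_congr fun b _ => ?_
    simp only [hFa, map_sum, tensor_mul_tmul, D.H.one_mul]
    rfl
  · rw [hFa, map_sum]; rfl
  · rw [forall_comm]
    refine forall₂_congr fun a b => ?_
    simp only [hFa, map_sum, LinearMap.sum_apply, tensor_mul_tmul]
    rfl

theorem IsFrobenius.homT_iff (hF : D.IsFrobenius) :
    (∃ f : A →ₗ[k] D.takeuchiT, (∀ a, (f a : D.H.BalTensor D.T) = hF.deltaT a) ∧
      D.V.IsAlgHom D.takeuchiAlgT f) ↔ D.rot.rot.ComulBMultiplicative := by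
  refine comulBMultiplicative_iff_of_forall hF.rot.rot fun n u v huv => ?_
  let F : A →ₗ[k] A ⊗[k] A :=
    ∑ j, TensorProduct.mk k A A (v j) ∘ₗ D.H.mul (u j)
  have hFa : ∀ a, F a = ∑ j, v j ⊗ₜ[k] (u j *[D.H] a) := by
    intro a; simp only [F, LinearMap.sum_apply]; rfl
  -- The rotated condition lives in the tensor product over T for Hᵒᵖ; the injective flip transports
  -- each equation from A ⊗_T A.
  have hflip : ∀ a b, D.H.op.btmul D.T a b = D.H.btflip D.T (D.H.btmul D.T b a) :=
    fun a b => (D.H.btflip_btmul D.T b a).symm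
  refine (D.V.exists_isAlgHom_rightTakeuchi_iff _ _ _ _ D.balRel_T D.V F hF.deltaT
    (fun a => ?_)).trans (and_congr ?_ (and_congr ?_ ?_))
  · rw [hFa, map_sum]; exact hF.frobT.comul_eq_right (op_isDualBasis.1 huv) a
  · refine forall_congr' fun a => forall₂_congr fun b _ => ?_
    simp only [hFa, map_sum, tensor_mul_tmul, D.V.one_mul]
    change _ ↔ ∑ j, D.H.op.btmul D.T (D.phiL b *[D.V] (u j *[D.H] a)) (v j)
      = ∑ j, D.H.op.btmul D.T (u j *[D.H] a) (D.phiR b *[D.V] v j)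
    simp only [hflip, ← map_sum]
    rw [(D.H.btflip_injective D.T).eq_iff, eq_comm]
    simp only [map_sum]
    rfl
  · rw [hFa, map_sum]
    change _ ↔ ∑ j, D.H.op.btmul D.T (u j *[D.H] D.V.one) (v j)
      = D.H.op.btmul D.T D.V.one D.V.one
    simp only [hflip, ← map_sum]
    rw [(D.H.btflip_injective D.T).eq_iff]
    simp only [map_sum]
    rfl
  · rw [forall_comm]
    refine forall₂_congr fun a b => ?_
    simp only [hFa, map_sum, LinearMap.sum_apply, tensor_mul_tmul]
    change _ ↔ ∑ j, D.H.op.btmul D.T (u j *[D.H] (b *[D.V] a)) (v j)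
      = ∑ i, ∑ j, D.H.op.btmul D.T ((u j *[D.H] b) *[D.V] (u i *[D.H] a)) (v j *[D.V] v i)
    simp only [hflip, ← map_sum]
    rw [(D.H.btflip_injective D.T).eq_iff]
    simp only [map_sum]
    rfl

theorem IsFrobenius.homL_iff (hF : D.IsFrobenius) :
    (∃ f : A →ₗ[k] D.takeuchiL, (∀ a, (f a : D.V.BalTensor D.L) = hF.deltaL a) ∧
      D.H.IsAlgHom D.takeuchiAlgL f) ↔ D.rot.rot.rot.ComulBMultiplicative := by
  refine comulBMultiplicative_iff_of_forall hF.rot.rot.rot fun n u v huv => ?_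
  let F : A →ₗ[k] A ⊗[k] A :=
    ∑ j, TensorProduct.mk k A A (v j) ∘ₗ D.V.mul (u j)
  have hFa : ∀ a, F a = ∑ j, v j ⊗ₜ[k] (u j *[D.V] a) := by
    intro a; simp only [F, LinearMap.sum_apply]; rfl
  have hflip : ∀ a b, D.V.op.btmul D.L a b = D.V.btflip D.L (D.V.btmul D.L b a) :=
    fun a b => (D.V.btflip_btmul D.L b a).symm
  refine (D.H.exists_isAlgHom_leftTakeuchi_iff _ _ _ _ D.balRel_L D.H F hF.deltaL
    (fun a => ?_)).trans (and_congr ?_ (and_congr ?_ ?_))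
  · rw [hFa, map_sum]; exact hF.frobL.comul_eq_right (op_isDualBasis.1 huv) a
  · refine forall_congr' fun a => forall₂_congr fun b _ => ?_
    simp only [hFa, map_sum, LinearMap.sum_apply, tensor_mul_tmul, D.H.mul_one]
    change _ ↔ ∑ j, D.V.op.btmul D.L ((u j *[D.V] a) *[D.H] D.phiB b) (v j)
      = ∑ j, D.V.op.btmul D.L (u j *[D.V] a) (v j *[D.H] D.phiT b)
    simp only [hflip, ← map_sum]
    rw [(D.V.btflip_injective D.L).eq_iff, eq_comm]
    simp only [map_sum]
    rfl
  · rw [hFa, map_sum]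
    change _ ↔ ∑ j, D.V.op.btmul D.L (u j *[D.V] D.H.one) (v j)
      = D.V.op.btmul D.L D.H.one D.H.one
    simp only [hflip, ← map_sum]
    rw [(D.V.btflip_injective D.L).eq_iff]
    simp only [map_sum]
    rfl
  · refine forall₂_congr fun a b => ?_
    simp only [hFa, map_sum, LinearMap.sum_apply, tensor_mul_tmul]
    change _ ↔ ∑ j, D.V.op.btmul D.L (u j *[D.V] (a *[D.H] b)) (v j)
      = ∑ i, ∑ j, D.V.op.btmul D.L ((u i *[D.V] a) *[D.H] (u j *[D.V] b)) (v i *[D.H] v j)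
    simp only [hflip, ← map_sum]
    rw [(D.V.btflip_injective D.L).eq_iff, Finset.sum_comm]
    simp only [map_sum]
    rfl

theorem IsFrobenius.isDistributive_iff (hF : D.IsFrobenius) :
    hF.IsDistributive ↔ D.DistributesB ∧ D.rot.DistributesB ∧ D.rot.rot.DistributesB ∧
      D.rot.rot.rot.DistributesB := by
  rw [← hF.distB_iff, ← hF.distR_iff, ← hF.distT_iff, ← hF.distL_iff]
  exact ⟨fun h => ⟨h.distB, h.distR, h.distT, h.distL⟩, fun h => ⟨h.1, h.2.2.2, h.2.2.1, h.2.1⟩⟩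

theorem IsFrobenius.comulAlgHom_iff (hF : D.IsFrobenius) :
    hF.ComulAlgHom ↔ D.ComulBMultiplicative ∧ D.rot.ComulBMultiplicative ∧
      D.rot.rot.ComulBMultiplicative ∧ D.rot.rot.rot.ComulBMultiplicative := by
  rw [← hF.homB_iff, ← hF.homR_iff, ← hF.homT_iff, ← hF.homL_iff]
  exact ⟨fun h => ⟨h.homB, h.homR, h.homT, h.homL⟩, fun h => ⟨h.1, h.2.2.2, h.2.2.1, h.2.1⟩⟩

end

end DoubleAlgebra

theorem mainTheorem2 {k A : Type*} [CommRing k] [AddCommGroup A] [Module k A]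
    (D : DoubleAlgebra k A) (hF : D.IsFrobenius) :
    hF.IsDistributive ↔ (∃ S : A →ₗ[k] A, D.IsAntipode S) ∧ hF.ComulAlgHom := by
  rw [hF.isDistributive_iff, hF.comulAlgHom_iff]
  constructor
  · rintro ⟨hB, hR, hT, hL⟩
    exact ⟨DoubleAlgebra.exists_isAntipode hF hB hR hT hL, hB.comulBMultiplicative hF hR,
      hR.comulBMultiplicative hF.rot hT, hT.comulBMultiplicative hF.rot.rot hL,
      hL.comulBMultiplicative hF.rot.rot.rot hB⟩
  · rintro ⟨⟨S, hS⟩, hB, hR, hT, hL⟩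
    exact ⟨hS.distributesB hF hB, hS.rot.distributesB hF.rot hR,
      hS.rot.rot.distributesB hF.rot.rot hT, hS.rot.rot.rot.distributesB hF.rot.rot.rot hL⟩
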